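/- Let $\mathcal{Q}$ be a small quantaloid, i.e. a small category whose hom-sets are complete lattices and whose composition preserves arbitrary suprema in each variable. Let $\mathsf{Mod}(\mathcal{Q})$ be the quantaloid of $\mathcal{Q}$-modules ($\mathsf{Sup}$-enriched functors $\mathcal{F}\colon\mathcal{Q}^{\mathrm{op}}\to\mathsf{Sup}$, with $\mathsf{Sup}$-natural transformations ordered pointwise), and let $\mathsf{Cocont}(\mathcal{Q})$ be the locally ordered 2-category of cocomplete $\mathcal{Q}$-enriched categories and cocontinuous functors. For $a\in\mathcal{F}(A)$ write $\tau_a\colon\mathcal{Q}(-,A)\Rightarrow\mathcal{F}$ for the corresponding module morphism; $a$ is a principal element of $\mathcal{F}$ if $\tau_a$ has a right adjoint in $\mathsf{Mod}(\mathcal{Q})$, and $\mathcal{F}$ is principally generated if for every element $x$ of $\mathcal{F}$ $$\tau_x=\bigvee\{\tau_a\circ[\tau_a,\tau_x]\mid a\text{ a principal element of }\mathcal{F}\},$$ where $[\tau_a,-]$ is the right adjoint of $\tau_a\circ-$. An object $a$, of type $A$, of a cocomplete $\mathcal{Q}$-category $\mathbb{A}$ is totally compact if $1_A\le\Theta_{\mathbb{A}}(a,a)$,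 where the distributor $\Theta_{\mathbb{A}}$ is the right extension of $\mathcal{P}\mathbb{A}(Y-,-)$ through $\mathbb{A}(-,\sup-)$, i.e. the largest $\Theta$ with $\Theta\otimes\mathbb{A}(-,\sup-)\le\mathcal{P}\mathbb{A}(Y-,-)$, with $Y\colon\mathbb{A}\to\mathcal{P}\mathbb{A}$ the Yoneda embedding into the $\mathcal{Q}$-category of presheaves and $\sup$ its left adjoint; $\mathbb{A}$ is totally algebraic if the left Kan extension along itself of the inclusion of the full subcategory of totally compact objects is isomorphic to $1_{\mathbb{A}}$. Let $\mathsf{Mod}(\mathcal{Q})\to\mathsf{Cocont}(\mathcal{Q})$ be the 2-functor sending $\mathcal{F}$ to the cocomplete $\mathcal{Q}$-category $\mathbb{A}_{\mathcal{F}}$ whose objects of type $X$ are the elements of $\mathcal{F}(X)$, with hom-arrows $$\mathbb{A}_{\mathcal{F}}(y,x)=\bigvee\{f\colon X\to Y\mid\mathcal{F}(f)(y)\le x\}\qquad(x\in\mathcal{F}(X),\ y\in\mathcal{F}(Y)),$$ and sending $\alpha\colon\mathcal{F}\Rightarrow\mathcal{G}$ to the cocontinuous functor $x\mapsto\alpha_X(x)$.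 Then: 1. this 2-functor is a biequivalence $\mathsf{Mod}(\mathcal{Q})\simeq\mathsf{Cocont}(\mathcal{Q})$; 2. for each $\mathcal{Q}$-module $\mathcal{F}$, an element $a\in\mathcal{F}(A)$ is totally compact as an object of $\mathbb{A}_{\mathcal{F}}$ if and only if it is a principal element of $\mathcal{F}$; 3. a $\mathcal{Q}$-module $\mathcal{F}$ is principally generated if and only if $\mathbb{A}_{\mathcal{F}}$ is totally algebraic, and the 2-functor restricts to a biequivalence $\mathsf{Mod}_{\mathsf{pg}}(\mathcal{Q})\simeq\mathsf{Cocont}_{\mathsf{ta}}(\mathcal{Q})$ between the full sub-2-categories of principally generated $\mathcal{Q}$-modules and of totally algebraic cocomplete $\mathcal{Q}$-categories. -/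

import Mathlib

open CategoryTheory

universe w v u

/-! ## Locally ordered categories and quantaloids

Composition is written in diagrammatic order throughout: `f ≫ g` is the composite `g ∘ f`. -/

/-- A locally ordered category (a 2-category whose hom-categories are preorders). -/
class LocOrd (C : Type u) extends Category.{v} C where
  homOrder : ∀ X Y : C, Preorder (X ⟶ Y)
  comp_mono : ∀ {X Y Z : C} {f f' : X ⟶ Y} {g g' : Y ⟶ Z},
    f ≤ f' → g ≤ g' → f ≫ g ≤ f' ≫ g'

attribute [reducible, instance] LocOrd.homOrder

/-- A quantaloid: a category whose hom-sets are complete lattices and in which composition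
preserves arbitrary suprema in each variable. -/
class Quantaloid (Q : Type u) extends Category.{v} Q where
  homLattice : ∀ X Y : Q, CompleteLattice (X ⟶ Y)
  sSup_comp : ∀ {X Y Z : Q} (S : Set (X ⟶ Y)) (g : Y ⟶ Z), sSup S ≫ g = ⨆ f ∈ S, f ≫ g
  comp_sSup : ∀ {X Y Z : Q} (f : X ⟶ Y) (S : Set (Y ⟶ Z)), f ≫ sSup S = ⨆ g ∈ S, f ≫ g

attribute [reducible, instance] Quantaloid.homLattice

namespace Quantaloid

variable {Q : Type u} [Quantaloid.{v} Q]

theorem comp_mono_left {X Y Z : Q} {f f' : X ⟶ Y} (h : f ≤ f') (g : Y ⟶ Z) :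
    f ≫ g ≤ f' ≫ g := by
  have h1 := sSup_comp {f, f'} g
  rw [sSup_pair, sup_eq_right.2 h] at h1
  rw [h1]
  exact le_iSup₂_of_le f (by simp) le_rfl

theorem comp_mono_right {X Y Z : Q} (f : X ⟶ Y) {g g' : Y ⟶ Z} (h : g ≤ g') :
    f ≫ g ≤ f ≫ g' := by
  have h1 := comp_sSup f {g, g'}
  rw [sSup_pair, sup_eq_right.2 h] at h1
  rw [h1]
  exact le_iSup₂_of_le g (by simp) le_rfl

instance toLocOrd : LocOrd Q where
  homOrder X Y := (homLattice X Y).toPartialOrder.toPreorder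
  comp_mono h h' := (comp_mono_left h _).trans (comp_mono_right _ h')

theorem iSup_comp {X Y Z : Q} {ι : Sort w} (f : ι → (X ⟶ Y)) (g : Y ⟶ Z) :
    (⨆ i, f i) ≫ g = ⨆ i, f i ≫ g := by
  rw [iSup, sSup_comp, iSup_range]

theorem comp_iSup {X Y Z : Q} {ι : Sort w} (f : X ⟶ Y) (g : ι → (Y ⟶ Z)) :
    f ≫ (⨆ i, g i) = ⨆ i, f ≫ g i := by
  rw [iSup, comp_sSup, iSup_range]

/-- The lifting `[f, g]` of `g : A ⟶ Y` through `f : X ⟶ Y`: the largest `h : A ⟶ X`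
with `f ∘ h ≤ g`. -/
def lift {A X Y : Q} (f : X ⟶ Y) (g : A ⟶ Y) : A ⟶ X := sSup {h | h ≫ f ≤ g}

/-- The extension `{f, g}` of `g : X ⟶ A` through `f : X ⟶ Y`: the largest `h : Y ⟶ A`
with `h ∘ f ≤ g`. -/
def ext {A X Y : Q} (f : X ⟶ Y) (g : X ⟶ A) : Y ⟶ A := sSup {h | f ≫ h ≤ g}

theorem le_lift_iff {A X Y : Q} {f : X ⟶ Y} {g : A ⟶ Y} {h : A ⟶ X} :
    h ≤ lift f g ↔ h ≫ f ≤ g := by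
  refine ⟨fun H => (comp_mono_left H f).trans ?_, fun H => le_sSup H⟩
  rw [lift, sSup_comp]
  exact iSup₂_le fun _ h => h

theorem lift_comp_le {A X Y : Q} (f : X ⟶ Y) (g : A ⟶ Y) : lift f g ≫ f ≤ g :=
  le_lift_iff.1 le_rfl

end Quantaloid

namespace LocOrd

variable {C : Type u} [LocOrd.{v} C]

/-- `f : X ⟶ Y` is left adjoint to `g : Y ⟶ X` in a locally ordered category. -/
def IsAdj {X Y : C} (f : X ⟶ Y) (g : Y ⟶ X) : Prop := 𝟙 X ≤ f ≫ g ∧ g ≫ f ≤ 𝟙 Y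

/-- `f` has a right adjoint. -/
def IsLeftAdj {X Y : C} (f : X ⟶ Y) : Prop := ∃ g : Y ⟶ X, IsAdj f g

/-- Isomorphism of parallel morphisms in a locally ordered category. -/
def Iso₂ {X Y : C} (f g : X ⟶ Y) : Prop := f ≤ g ∧ g ≤ f

/-- `k : B ⟶ Z` is a left Kan extension of `f : A ⟶ Z` along `i : A ⟶ B`. -/
def IsLan {A B Z : C} (i : A ⟶ B) (f : A ⟶ Z) (k : B ⟶ Z) : Prop :=
  ∀ h : B ⟶ Z, k ≤ h ↔ f ≤ i ≫ h

/-- A locally ordered category as a bicategory: there is a unique 2-cell `f ⟶ g`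
exactly when `f ≤ g`. -/
instance toBicategory : Bicategory C where
  homCategory X Y := Preorder.smallCategory (X ⟶ Y)
  whiskerLeft f _ _ η := homOfLE (comp_mono le_rfl (leOfHom η))
  whiskerRight η h := homOfLE (comp_mono (leOfHom η) le_rfl)
  associator f g h := eqToIso (Category.assoc f g h)
  leftUnitor f := eqToIso (Category.id_comp f)
  rightUnitor f := eqToIso (Category.comp_id f)

/-- The full sub-2-category of a locally ordered category on the objects satisfying `P`. -/
structure FullSub (P : C → Prop) where
  obj : C
  property : P obj

instance (P : C → Prop) : LocOrd.{v} (FullSub P) where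
  Hom X Y := X.obj ⟶ Y.obj
  id X := 𝟙 X.obj
  comp f g := f ≫ g
  id_comp := fun {X Y} (f : X.obj ⟶ Y.obj) => Category.id_comp f
  comp_id := fun {X Y} (f : X.obj ⟶ Y.obj) => Category.comp_id f
  assoc := fun {X Y Z W} (f : X.obj ⟶ Y.obj) (g : Y.obj ⟶ Z.obj) (h : Z.obj ⟶ W.obj) =>
    Category.assoc f g h
  homOrder X Y := homOrder X.obj Y.obj
  comp_mono := fun {X Y Z} {f f' : X.obj ⟶ Y.obj} {g g' : Y.obj ⟶ Z.obj} h h' =>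
    comp_mono (C := C) h h'

end LocOrd

/-- A (strict) 2-functor between locally ordered categories. -/
structure TwoFunctor (C : Type*) [LocOrd C] (D : Type*) [LocOrd D] where
  obj : C → D
  map : ∀ {X Y : C}, (X ⟶ Y) → (obj X ⟶ obj Y)
  map_id : ∀ X : C, map (𝟙 X) = 𝟙 (obj X)
  map_comp : ∀ {X Y Z : C} (f : X ⟶ Y) (g : Y ⟶ Z), map (f ≫ g) = map f ≫ map g
  map_mono : ∀ {X Y : C} {f g : X ⟶ Y}, f ≤ g → map f ≤ map g

namespace TwoFunctor

variable {C : Type*} [LocOrd C] {D : Type*} [LocOrd D]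

/-- A 2-functor as a pseudofunctor of bicategories. -/
def toPseudofunctor (T : TwoFunctor C D) : Pseudofunctor C D where
  obj := T.obj
  map := T.map
  map₂ η := homOfLE (T.map_mono (leOfHom η))
  mapId X := eqToIso (T.map_id X)
  mapComp f g := eqToIso (T.map_comp f g)

/-- The restriction of a 2-functor to full sub-2-categories. -/
def restrict (T : TwoFunctor C D) (P : C → Prop) (R : D → Prop)
    (h : ∀ X, P X → R (T.obj X)) :
    TwoFunctor (LocOrd.FullSub P) (LocOrd.FullSub R) where
  obj X := ⟨T.obj X.obj, h X.obj X.property⟩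
  map {X Y} (f : X.obj ⟶ Y.obj) := T.map f
  map_id X := T.map_id X.obj
  map_comp {X Y Z} (f : X.obj ⟶ Y.obj) (g : Y.obj ⟶ Z.obj) := T.map_comp f g
  map_mono {X Y} {f g : X.obj ⟶ Y.obj} hfg := T.map_mono hfg

end TwoFunctor

/-- A pseudofunctor is a biequivalence when it is locally an equivalence of categories and
surjective on objects up to equivalence. -/
def IsBiequivalence {B : Type*} [Bicategory B] {C : Type*} [Bicategory C]
    (T : Pseudofunctor B C) : Prop :=
  (∀ a b : B, (T.toPrelaxFunctor.mapFunctor a b).IsEquivalence) ∧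
    ∀ c : C, ∃ a : B, Nonempty (Bicategory.Equivalence (T.obj a) c)

/-! ## Modules on a small quantaloid -/

/-- A `Q`-module: a `Sup`-enriched functor `Q^op ⟶ Sup`. -/
structure QMod (Q : Type u) [Quantaloid.{u} Q] where
  obj : Q → Type u
  [lat : ∀ X, CompleteLattice (obj X)]
  act : ∀ {X Y : Q}, (X ⟶ Y) → sSupHom (obj Y) (obj X)
  act_id : ∀ (X : Q) (x : obj X), act (𝟙 X) x = x
  act_comp : ∀ {X Y Z : Q} (f : X ⟶ Y) (g : Y ⟶ Z) (z : obj Z),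
    act (f ≫ g) z = act f (act g z)
  act_sSup : ∀ {X Y : Q} (S : Set (X ⟶ Y)) (y : obj Y), act (sSup S) y = ⨆ f ∈ S, act f y

attribute [instance] QMod.lat

namespace QMod

variable {Q : Type u} [Quantaloid.{u} Q]

/-- A module morphism: a `Sup`-natural transformation. -/
@[ext]
structure Hom (F G : QMod Q) where
  app : ∀ X : Q, sSupHom (F.obj X) (G.obj X)
  naturality : ∀ {X Y : Q} (f : X ⟶ Y) (y : F.obj Y),
    app X (F.act f y) = G.act f (app Y y)

theorem Hom.ext' {F G : QMod Q} {α β : Hom F G} (h : ∀ X x, α.app X x = β.app X x) : α = β :=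
  Hom.ext (funext fun X => DFunLike.ext _ _ (h X))

instance : Category.{u} (QMod Q) where
  Hom F G := Hom F G
  id F := ⟨fun X => sSupHom.id (F.obj X), fun _ _ => rfl⟩
  comp α β := ⟨fun X => (β.app X).comp (α.app X), fun f y => by
    simp only [sSupHom.comp_apply, α.naturality, β.naturality]⟩

@[simp] theorem id_app (F : QMod Q) (X : Q) (x : F.obj X) : Hom.app (𝟙 F) X x = x := rfl

@[simp] theorem comp_app {F G H : QMod Q} (α : F ⟶ G) (β : G ⟶ H) (X : Q) (x : F.obj X) :
    Hom.app (α ≫ β) X x = Hom.app β X (Hom.app α X x) := rfl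

/-- Module morphisms are ordered pointwise. -/
instance (F G : QMod Q) : PartialOrder (F ⟶ G) where
  le α β := ∀ X x, Hom.app α X x ≤ Hom.app β X x
  le_refl _ _ _ := le_rfl
  le_trans _ _ _ h h' X x := (h X x).trans (h' X x)
  le_antisymm _ _ h h' := Hom.ext' fun X x => le_antisymm (h X x) (h' X x)

/-- Suprema of module morphisms are computed pointwise. -/
instance (F G : QMod Q) : SupSet (F ⟶ G) where
  sSup S :=
    { app := fun X =>
        { toFun := fun x => ⨆ α ∈ S, Hom.app α X x
          map_sSup' := fun T => by
            simp only [map_sSup, sSup_image]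
            rw [iSup₂_comm] }
      naturality := fun f y => by
        change (⨆ α ∈ S, Hom.app α _ _) = G.act f (⨆ α ∈ S, Hom.app α _ _)
        simp only [map_iSup, Hom.naturality] }

theorem sSup_app {F G : QMod Q} (S : Set (F ⟶ G)) (X : Q) (x : F.obj X) :
    Hom.app (sSup S : F ⟶ G) X x = ⨆ α ∈ S, Hom.app α X x := rfl

instance homCompleteLattice (F G : QMod Q) : CompleteLattice (F ⟶ G) :=
  completeLatticeOfSup (F ⟶ G) fun S =>
    ⟨fun α hα X x => le_iSup₂_of_le (f := fun β (_ : β ∈ S) => Hom.app β X x) α hα le_rfl,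
      fun _ hβ X x => iSup₂_le fun _ hα => hβ hα X x⟩

theorem iSup_app {F G : QMod Q} {ι : Sort w} (α : ι → (F ⟶ G)) (X : Q) (x : F.obj X) :
    Hom.app (⨆ i, α i : F ⟶ G) X x = ⨆ i, Hom.app (α i) X x := by
  change (⨆ β ∈ Set.range α, Hom.app β X x) = _
  rw [iSup_range]

/-- `Mod(Q)` is a (large) quantaloid. -/
instance : Quantaloid.{u} (QMod Q) where
  homLattice F G := homCompleteLattice F G
  sSup_comp S β := Hom.ext' fun X x => by
    simp only [iSup_app, comp_app, sSup_app, map_iSup]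
  comp_sSup α S := Hom.ext' fun X x => by
    simp only [iSup_app, comp_app, sSup_app]

/-- The representable module `Q(-, A)`. -/
def yon (A : Q) : QMod Q where
  obj X := X ⟶ A
  act f :=
    { toFun := fun g => f ≫ g
      map_sSup' := fun S => by rw [Quantaloid.comp_sSup, sSup_image] }
  act_id _ x := Category.id_comp x
  act_comp f g z := Category.assoc f g z
  act_sSup S y := Quantaloid.sSup_comp S y

/-- The morphism `τ_a : Q(-, A) ⟶ F` corresponding to `a ∈ F(A)` by the Yoneda lemma. -/
def tau (F : QMod Q) {A : Q} (a : F.obj A) : yon A ⟶ F :=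
  Hom.mk (fun _ =>
      { toFun := fun f => F.act f a
        map_sSup' := fun S => by
          exact (F.act_sSup S a).trans sSup_image.symm })
    (fun f g => F.act_comp f g a)

/-- `a` is a principal element of `F`. -/
def IsPrincipal (F : QMod Q) {A : Q} (a : F.obj A) : Prop := LocOrd.IsLeftAdj (F.tau a)

/-- `F` is principally generated: for every element `x`, `τ_x` is the supremum of all
`τ_a ∘ [τ_a, τ_x]` with `a` principal. -/
def IsPrincipallyGenerated (F : QMod Q) : Prop :=
  ∀ (X : Q) (x : F.obj X),
    F.tau x = ⨆ (A : Q) (a : F.obj A) (_ : F.IsPrincipal a),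
      Quantaloid.lift (F.tau a) (F.tau x) ≫ F.tau a

end QMod

/-! ## Categories, functors and distributors enriched in a small quantaloid -/

/-- A `Q`-category. The set of objects with its type function is given by its fibres:
`obj X` is the set of objects of type `X`. The hom-arrow `hom a' a` is `𝔸(a', a) : ta ⟶ ta'`. -/
structure QCategory (Q : Type u) [Quantaloid.{u} Q] where
  obj : Q → Type u
  hom : ∀ {X Y : Q}, obj Y → obj X → (X ⟶ Y)
  comp_le : ∀ {X Y Z : Q} (a : obj X) (a' : obj Y) (a'' : obj Z),
    hom a' a ≫ hom a'' a' ≤ hom a'' a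
  id_le : ∀ {X : Q} (a : obj X), 𝟙 X ≤ hom a a

namespace QCategory

variable {Q : Type u} [Quantaloid.{u} Q]

/-- A functor of `Q`-categories: a type-preserving map with `𝔸(a', a) ≤ 𝔹(Fa', Fa)`. -/
@[ext]
structure QFunctor (A B : QCategory Q) where
  obj : ∀ {X : Q}, A.obj X → B.obj X
  map_le : ∀ {X Y : Q} (a' : A.obj Y) (a : A.obj X), A.hom a' a ≤ B.hom (obj a') (obj a)

/-- The 2-category `Cat(Q)`; here `F ≤ G` means that `Fa ≤ Ga` in the underlying order of the
codomain, i.e. `1 ≤ 𝔹(Fa, Ga)`, for every object `a`. -/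
instance : LocOrd.{u} (QCategory Q) where
  Hom A B := QFunctor A B
  id A := ⟨fun a => a, fun _ _ => le_rfl⟩
  comp F G := ⟨fun a => G.obj (F.obj a), fun a' a => (F.map_le a' a).trans (G.map_le _ _)⟩
  homOrder A B :=
    { le := fun F G => ∀ (X : Q) (a : A.obj X), 𝟙 X ≤ B.hom (F.obj a) (G.obj a)
      le_refl := fun F _ a => B.id_le (F.obj a)
      le_trans := fun F G H h h' X a => by
        have h1 := Quantaloid.comp_mono_left (h' X a) (𝟙 X)
        have h2 := Quantaloid.comp_mono_right (B.hom (G.obj a) (H.obj a)) (h X a)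
        rw [Category.comp_id] at h1
        exact (h1.trans h2).trans (B.comp_le _ _ _) }
  comp_mono := fun {A B C} {F F'} {G G'} h h' X a => by
    have h1 : 𝟙 X ≤ C.hom (G.obj (F.obj a)) (G.obj (F'.obj a)) := (h X a).trans (G.map_le _ _)
    have h2 := h' X (F'.obj a)
    have h3 := Quantaloid.comp_mono_left h2 (𝟙 X)
    have h4 := Quantaloid.comp_mono_right (C.hom (G.obj (F'.obj a)) (G'.obj (F'.obj a))) h1
    rw [Category.comp_id] at h3
    exact (h3.trans h4).trans (C.comp_le _ _ _)

/-- A distributor `Φ : 𝔸 ⇸ 𝔹`, with elements `el b a = Φ(b, a) : ta ⟶ tb`. -/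
@[ext]
structure Distributor (A B : QCategory Q) where
  el : ∀ {X Y : Q}, B.obj Y → A.obj X → (X ⟶ Y)
  hom_comp_le : ∀ {X Y Y' : Q} (b : B.obj Y) (b' : B.obj Y') (a : A.obj X),
    el b' a ≫ B.hom b b' ≤ el b a
  comp_hom_le : ∀ {X X' Y : Q} (b : B.obj Y) (a' : A.obj X') (a : A.obj X),
    A.hom a' a ≫ el b a' ≤ el b a

theorem Distributor.ext' {A B : QCategory Q} {Φ Ψ : Distributor A B}
    (h : ∀ {X Y : Q} (b : B.obj Y) (a : A.obj X), Φ.el b a = Ψ.el b a) : Φ = Ψ := by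
  apply Distributor.ext
  funext X Y b a
  exact h b a

/-- The composite `Ψ ⊗ Φ` of distributors. -/
def Distributor.comp {A B C : QCategory Q} (Φ : Distributor A B) (Ψ : Distributor B C) :
    Distributor A C where
  el c a := ⨆ (Y : Q) (b : B.obj Y), Φ.el b a ≫ Ψ.el c b
  hom_comp_le c c' a := by
    simp only [Quantaloid.iSup_comp, Category.assoc]
    exact iSup₂_mono fun _ b => Quantaloid.comp_mono_right _ (Ψ.hom_comp_le c c' b)
  comp_hom_le c a' a := by
    simp only [Quantaloid.comp_iSup, ← Category.assoc]
    exact iSup₂_mono fun _ b => Quantaloid.comp_mono_left (Φ.comp_hom_le b a' a) _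

/-- The identity distributor on `𝔸`, with elements `𝔸(a', a)`. -/
def Distributor.id (A : QCategory Q) : Distributor A A where
  el a' a := A.hom a' a
  hom_comp_le b b' a := A.comp_le a b' b
  comp_hom_le b a' a := A.comp_le a a' b

end QCategory

/-- The objects of `Dist(Q)`: `Q`-categories, with distributors as morphisms. -/
structure DistCat (Q : Type u) [Quantaloid.{u} Q] where
  cat : QCategory Q

namespace DistCat

open QCategory

variable {Q : Type u} [Quantaloid.{u} Q]

instance : Category.{u} (DistCat Q) where
  Hom A B := Distributor A.cat B.cat
  id A := Distributor.id A.cat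
  comp Φ Ψ := Distributor.comp Φ Ψ
  id_comp {A B} Φ := Distributor.ext' fun {X Y} b a => by
    refine le_antisymm (iSup₂_le fun Z a' => Distributor.comp_hom_le Φ b a' a) ?_
    refine le_iSup₂_of_le (f := fun Z a' => A.cat.hom a' a ≫ Φ.el b a') X a ?_
    have h := Quantaloid.comp_mono_left (A.cat.id_le a) (Φ.el b a)
    rwa [Category.id_comp] at h
  comp_id {A B} Φ := Distributor.ext' fun {X Y} b a => by
    refine le_antisymm (iSup₂_le fun Z b' => Distributor.hom_comp_le Φ b b' a) ?_
    refine le_iSup₂_of_le (f := fun Z b' => Φ.el b' a ≫ B.cat.hom b b') Y b ?_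
    have h := Quantaloid.comp_mono_right (Φ.el b a) (B.cat.id_le b)
    rwa [Category.comp_id] at h
  assoc {A B C D} Φ Ψ Ω := Distributor.ext' fun {X Y} d a => by
    change (⨆ (Z : Q) (c : C.cat.obj Z),
        (⨆ (W : Q) (b : B.cat.obj W), Φ.el b a ≫ Ψ.el c b) ≫ Ω.el d c) =
      ⨆ (W : Q) (b : B.cat.obj W), Φ.el b a ≫
        (⨆ (Z : Q) (c : C.cat.obj Z), Ψ.el c b ≫ Ω.el d c)
    simp only [Quantaloid.iSup_comp, Quantaloid.comp_iSup, Category.assoc]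
    rw [iSup₂_comm]

theorem comp_el {A B C : DistCat Q} (Φ : A ⟶ B) (Ψ : B ⟶ C) {X Z : Q} (c : C.cat.obj Z)
    (a : A.cat.obj X) : Distributor.el (Φ ≫ Ψ) c a =
      ⨆ (Y : Q) (b : B.cat.obj Y), Distributor.el Φ b a ≫ Distributor.el Ψ c b := rfl

/-- Distributors are ordered elementwise. -/
instance (A B : DistCat Q) : PartialOrder (A ⟶ B) where
  le Φ Ψ := ∀ (X Y : Q) (b : B.cat.obj Y) (a : A.cat.obj X),
    Distributor.el Φ b a ≤ Distributor.el Ψ b a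
  le_refl _ _ _ _ _ := le_rfl
  le_trans _ _ _ h h' X Y b a := (h X Y b a).trans (h' X Y b a)
  le_antisymm _ _ h h' := Distributor.ext' fun b a => le_antisymm (h _ _ b a) (h' _ _ b a)

/-- Suprema of distributors are computed elementwise. -/
instance (A B : DistCat Q) : SupSet (A ⟶ B) where
  sSup S := Distributor.mk (fun b a => ⨆ Φ ∈ S, Distributor.el Φ b a)
    (fun b b' a => by
      simp only [Quantaloid.iSup_comp]
      exact iSup₂_mono fun Φ _ => Distributor.hom_comp_le Φ b b' a)
    (fun b a' a => by
      simp only [Quantaloid.comp_iSup]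
      exact iSup₂_mono fun Φ _ => Distributor.comp_hom_le Φ b a' a)

theorem sSup_el {A B : DistCat Q} (S : Set (A ⟶ B)) {X Y : Q} (b : B.cat.obj Y)
    (a : A.cat.obj X) : Distributor.el (sSup S : A ⟶ B) b a = ⨆ Φ ∈ S, Distributor.el Φ b a := rfl

instance homCompleteLattice (A B : DistCat Q) : CompleteLattice (A ⟶ B) :=
  completeLatticeOfSup (A ⟶ B) fun S =>
    ⟨fun Φ hΦ X Y b a =>
        le_iSup₂_of_le (f := fun Ψ (_ : Ψ ∈ S) => Distributor.el Ψ b a) Φ hΦ le_rfl,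
      fun _ hΨ X Y b a => iSup₂_le fun _ hΦ => hΨ hΦ X Y b a⟩

theorem iSup_el {A B : DistCat Q} {ι : Sort w} (Φ : ι → (A ⟶ B)) {X Y : Q} (b : B.cat.obj Y)
    (a : A.cat.obj X) : Distributor.el (⨆ i, Φ i : A ⟶ B) b a = ⨆ i, Distributor.el (Φ i) b a := by
  change (⨆ Ψ ∈ Set.range Φ, Distributor.el Ψ b a) = _
  rw [iSup_range]

/-- `Dist(Q)` is a (large) quantaloid. -/
instance : Quantaloid.{u} (DistCat Q) where
  homLattice A B := homCompleteLattice A B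
  sSup_comp {A B C} S Ψ := Distributor.ext' fun {X Y} c a => by
    simp only [iSup_el, comp_el, sSup_el, Quantaloid.iSup_comp]
    rw [iSup₂_comm]
  comp_sSup {A B C} Φ S := Distributor.ext' fun {X Y} c a => by
    simp only [iSup_el, comp_el, sSup_el, Quantaloid.comp_iSup]
    rw [iSup₂_comm]

/-- Liftings of distributors, elementwise. -/
theorem le_lift_el {A B C : DistCat Q} (Φ : B ⟶ C) (Ψ : A ⟶ C) {X Y : Q} (b : B.cat.obj Y)
    (a : A.cat.obj X) (f : X ⟶ Y) :
    f ≤ Distributor.el (Quantaloid.lift Φ Ψ) b a ↔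
      ∀ (Z : Q) (c : C.cat.obj Z), f ≫ Distributor.el Φ c b ≤ Distributor.el Ψ c a := by
  constructor
  · intro h Z c
    refine (Quantaloid.comp_mono_left h _).trans ?_
    refine le_trans ?_ (Quantaloid.lift_comp_le Φ Ψ X Z c a)
    exact le_iSup₂_of_le
      (f := fun W b' => Distributor.el (Quantaloid.lift Φ Ψ) b' a ≫ Distributor.el Φ c b')
      Y b le_rfl
  · intro h
    let Θ : A ⟶ B := Distributor.mk
      (fun {X Y} b a => sSup {f : X ⟶ Y | ∀ (Z : Q) (c : C.cat.obj Z),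
        f ≫ Distributor.el Φ c b ≤ Distributor.el Ψ c a})
      (fun b b' a => by
        rw [Quantaloid.sSup_comp]
        refine iSup₂_le fun g hg => le_sSup fun Z c => ?_
        rw [Category.assoc]
        exact (Quantaloid.comp_mono_right g (Distributor.comp_hom_le Φ c b b')).trans (hg Z c))
      (fun b a' a => by
        rw [Quantaloid.comp_sSup]
        refine iSup₂_le fun g hg => le_sSup fun Z c => ?_
        rw [Category.assoc]
        exact (Quantaloid.comp_mono_right _ (hg Z c)).trans (Distributor.comp_hom_le Ψ c a' a))
    have hΘ : Θ ≤ Quantaloid.lift Φ Ψ := by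
      rw [Quantaloid.le_lift_iff]
      intro X Z c a
      refine iSup₂_le fun Y b => ?_
      change sSup _ ≫ _ ≤ _
      rw [Quantaloid.sSup_comp]
      exact iSup₂_le fun g hg => hg Z c
    have hf : f ≤ Distributor.el Θ b a :=
      le_sSup (show f ∈ {f : X ⟶ Y | ∀ (Z : Q) (c : C.cat.obj Z),
        f ≫ Distributor.el Φ c b ≤ Distributor.el Ψ c a} from h)
    exact hf.trans (hΘ X Y b a)

end DistCat

namespace QCategory

variable {Q : Type u} [Quantaloid.{u} Q]

/-- A `Q`-category viewed as an object of `Dist(Q)`. -/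
abbrev d (A : QCategory Q) : DistCat Q := ⟨A⟩

/-- The distributor `𝔹(-, F-) : 𝔸 ⇸ 𝔹`. -/
def lowerStar {A B : QCategory Q} (F : A ⟶ B) : A.d ⟶ B.d :=
  Distributor.mk (fun b a => B.hom b (QFunctor.obj F a))
    (fun b b' a => B.comp_le _ _ _)
    (fun b a' a => (Quantaloid.comp_mono_left (QFunctor.map_le F a' a) _).trans (B.comp_le _ _ _))

/-- The distributor `𝔹(F-, -) : 𝔹 ⇸ 𝔸`. -/
def upperStar {A B : QCategory Q} (F : A ⟶ B) : B.d ⟶ A.d :=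
  Distributor.mk (fun a b => B.hom (QFunctor.obj F a) b)
    (fun a a' b => (Quantaloid.comp_mono_right _ (QFunctor.map_le F a a')).trans (B.comp_le _ _ _))
    (fun b a' a => B.comp_le _ _ _)

/-- `K` is the `Φ`-weighted colimit of `F`: `ℂ(K-, -) = [Φ, ℂ(F-, -)]` in `Dist(Q)`. -/
def IsColim {A B C : QCategory Q} (Φ : A.d ⟶ B.d) (F : B ⟶ C) (K : A ⟶ C) : Prop :=
  upperStar K = Quantaloid.lift Φ (upperStar F)

/-- `ℂ` is cocomplete: it admits all weighted colimits. -/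
def IsCocomplete (C : QCategory Q) : Prop :=
  ∀ (A B : QCategory Q) (Φ : A.d ⟶ B.d) (F : B ⟶ C), ∃ K : A ⟶ C, IsColim Φ F K

/-- `H` is cocontinuous: it preserves all weighted colimits that exist in its domain. -/
def IsCocontinuous {C C' : QCategory Q} (H : C ⟶ C') : Prop :=
  ∀ (A B : QCategory Q) (Φ : A.d ⟶ B.d) (F : B ⟶ C) (K : A ⟶ C),
    IsColim Φ F K → IsColim Φ (F ≫ H) (K ≫ H)

theorem isColim_iff {A B C : QCategory Q} (Φ : A.d ⟶ B.d) (F : B ⟶ C) (K : A ⟶ C) :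
    IsColim Φ F K ↔ ∀ {X Y : Q} (a : A.obj Y) (c : C.obj X) (f : X ⟶ Y),
      f ≤ C.hom (QFunctor.obj K a) c ↔ ∀ (Z : Q) (b : B.obj Z),
        f ≫ Distributor.el Φ b a ≤ C.hom (QFunctor.obj F b) c := by
  constructor
  · intro h X Y a c f
    refine Iff.trans ?_ (DistCat.le_lift_el Φ (upperStar F) a c f)
    rw [← h]
    exact Iff.rfl
  · intro h
    refine Distributor.ext' fun {X Y} a c => eq_of_forall_le_iff fun f => ?_
    exact (h a c f).trans (DistCat.le_lift_el Φ (upperStar F) a c f).symm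

/-- The objects of the one-object `Q`-category `*_X`: a single object, of type `X`. -/
inductive Star (X : Q) : Q → Type u
  | pt : Star X X

/-- The hom-arrows of `*_X`: the identity `1_X`. -/
def Star.hom (X : Q) : ∀ {Y Z : Q}, Star X Z → Star X Y → (Y ⟶ Z)
  | _, _, Star.pt, Star.pt => 𝟙 X

/-- The one-object `Q`-category `*_X` whose single hom-arrow is `1_X`. -/
def star (X : Q) : QCategory Q where
  obj := Star X
  hom := Star.hom X
  comp_le a a' a'' := by
    cases a; cases a'; cases a''
    exact (Category.comp_id _).le
  id_le a := by
    cases a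
    exact le_rfl

/-- The single object of `*_X`. -/
def pt (X : Q) : (star X).obj X := Star.pt

/-- The functor `Δa : *_{ta} ⟶ 𝔸` picking out the object `a`. -/
def delta (A : QCategory Q) {X : Q} (a : A.obj X) : star X ⟶ A :=
  QFunctor.mk (fun {Y} (s : Star X Y) => match Y, s with | _, Star.pt => a)
    (fun s' s => by
      cases s; cases s'
      exact A.id_le a)

/-- The `Q`-category `𝒫𝔸` of contravariant presheaves: its objects of type `X` are the
distributors `*_X ⇸ 𝔸`, and its hom-arrows are given by lifting in `Dist(Q)`. -/
def presheaf (A : QCategory Q) : QCategory Q where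
  obj X := (star X).d ⟶ A.d
  hom {X Y} ψ φ := Distributor.el (Quantaloid.lift ψ φ) (pt Y) (pt X)
  comp_le {X Y Z} φ ψ χ := by
    have h : Quantaloid.lift ψ φ ≫ Quantaloid.lift χ ψ ≤ Quantaloid.lift χ φ := by
      rw [Quantaloid.le_lift_iff, Category.assoc]
      exact (Quantaloid.comp_mono_right _ (Quantaloid.lift_comp_le χ ψ)).trans
        (Quantaloid.lift_comp_le ψ φ)
    refine le_trans ?_ (h X Z (pt Z) (pt X))
    exact le_iSup₂_of_le (f := fun W b => Distributor.el (Quantaloid.lift ψ φ) b (pt X) ≫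
      Distributor.el (Quantaloid.lift χ ψ) (pt Z) b) Y (pt Y) le_rfl
  id_le {X} φ := by
    have h : 𝟙 (star X).d ≤ Quantaloid.lift φ φ := by
      rw [Quantaloid.le_lift_iff, Category.id_comp]
    exact h X X (pt X) (pt X)

theorem le_presheaf_hom (A : QCategory Q) {X Y : Q} (ψ : A.presheaf.obj Y) (φ : A.presheaf.obj X)
    (f : X ⟶ Y) : f ≤ A.presheaf.hom ψ φ ↔ ∀ (Z : Q) (a : A.obj Z),
      f ≫ Distributor.el ψ a (pt Y) ≤ Distributor.el φ a (pt X) :=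
  DistCat.le_lift_el ψ φ (pt Y) (pt X) f

/-- The Yoneda embedding `𝔸 ⟶ 𝒫𝔸`, `a ↦ 𝔸(-, a)`. -/
def yoneda (A : QCategory Q) : A ⟶ A.presheaf :=
  QFunctor.mk (B := A.presheaf) (fun a => lowerStar (A.delta a)) (fun a' a => by
    exact (A.le_presheaf_hom _ _ _).2 fun Z c => A.comp_le _ _ _)

/-- In a cocomplete `Q`-category the Yoneda embedding has a left adjoint. -/
theorem IsCocomplete.exists_sup {A : QCategory Q} (hA : A.IsCocomplete) :
    ∃ S : A.presheaf ⟶ A, LocOrd.IsAdj S A.yoneda := by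
  let E : A.presheaf.d ⟶ A.d := Distributor.mk
    (fun {X Y} (a : A.obj Y) (φ : A.presheaf.obj X) => Distributor.el φ a (pt X))
    (fun {X Y Y'} b b' φ => Distributor.hom_comp_le φ b b' (pt X))
    (fun {X X' Y} b ψ φ => (A.le_presheaf_hom ψ φ _).1 le_rfl Y b)
  obtain ⟨S, hS⟩ := hA A.presheaf A E (𝟙 A)
  rw [isColim_iff] at hS
  refine ⟨S, fun X φ => ?_, fun X a => ?_⟩
  · refine (A.le_presheaf_hom _ _ _).2 fun Z a => ?_
    rw [Category.id_comp]
    have h := (hS φ (QFunctor.obj S φ) (𝟙 X)).1 (A.id_le _) Z a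
    rwa [Category.id_comp] at h
  · refine (hS (QFunctor.obj A.yoneda a) a (𝟙 X)).2 fun Z b => ?_
    rw [Category.id_comp]
    exact le_rfl

end QCategory

/-- The objects of `Cocont(Q)`: cocomplete `Q`-categories. -/
structure Cocont (Q : Type u) [Quantaloid.{u} Q] where
  cat : QCategory Q
  cocomplete : cat.IsCocomplete

namespace Cocont

open QCategory

variable {Q : Type u} [Quantaloid.{u} Q]

/-- The morphisms of `Cocont(Q)`: cocontinuous functors. -/
@[ext]
structure Hom (A B : Cocont Q) where
  functor : A.cat ⟶ B.cat
  cocontinuous : IsCocontinuous functor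

/-- `Cocont(Q)` is a locally full sub-2-category of `Cat(Q)`. -/
instance : LocOrd.{u} (Cocont Q) where
  Hom A B := Hom A B
  id A := ⟨𝟙 A.cat, fun _ _ _ _ _ h => h⟩
  comp F G := ⟨F.functor ≫ G.functor, fun A B Φ H K h =>
    G.cocontinuous A B Φ (H ≫ F.functor) (K ≫ F.functor) (F.cocontinuous A B Φ H K h)⟩
  homOrder A B := Preorder.lift Hom.functor
  comp_mono {A B C} {F F'} {G G'} h h' :=
    LocOrd.comp_mono (f := F.functor) (f' := F'.functor) (g := G.functor) (g' := G'.functor) h h'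

/-- The left adjoint `sup : 𝒫𝔸 ⟶ 𝔸` of the Yoneda embedding. -/
noncomputable def sup (A : Cocont Q) : A.cat.presheaf ⟶ A.cat :=
  A.cocomplete.exists_sup.choose

theorem sup_isAdj (A : Cocont Q) : LocOrd.IsAdj A.sup A.cat.yoneda :=
  A.cocomplete.exists_sup.choose_spec

/-- The totally below distributor: the right extension `{𝔸(-, sup-), 𝒫𝔸(Y-, -)}` in `Dist(Q)`. -/
noncomputable def totallyBelow (A : Cocont Q) : A.cat.d ⟶ A.cat.d :=
  Quantaloid.ext (lowerStar A.sup) (upperStar A.cat.yoneda)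

/-- `a` is totally compact: `1_{ta} ≤ Θ(a, a)`. -/
def IsTotallyCompact (A : Cocont Q) {X : Q} (a : A.cat.obj X) : Prop :=
  𝟙 X ≤ Distributor.el A.totallyBelow a a

/-- The full subcategory `𝔸_c` of totally compact objects. -/
def compacts (A : Cocont Q) : QCategory Q where
  obj X := {a : A.cat.obj X // A.IsTotallyCompact a}
  hom a' a := A.cat.hom a'.1 a.1
  comp_le a a' a'' := A.cat.comp_le a.1 a'.1 a''.1
  id_le a := A.cat.id_le a.1

/-- The full embedding `𝔸_c ⟶ 𝔸`. -/
def inclusion (A : Cocont Q) : A.compacts ⟶ A.cat :=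
  QFunctor.mk (A := A.compacts) (fun a => a.1) (fun _ _ => le_rfl)

/-- `𝔸` is totally algebraic: the left Kan extension of `𝔸_c ⟶ 𝔸` along itself, in the
2-category `Cat(Q)`, is isomorphic to the identity. -/
def IsTotallyAlgebraic (A : Cocont Q) : Prop :=
  ∃ K : A.cat ⟶ A.cat, LocOrd.IsLan A.inclusion A.inclusion K ∧ LocOrd.Iso₂ K (𝟙 A.cat)

end Cocont

/-! ## The comparison of modules with cocomplete categories -/

namespace QMod

open QCategory

variable {Q : Type u} [Quantaloid.{u} Q]

theorem act_mono_left (F : QMod Q) {X Y : Q} {f g : X ⟶ Y} (h : f ≤ g) (y : F.obj Y) :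
    F.act f y ≤ F.act g y := by
  have h1 := F.act_sSup {f, g} y
  rw [sSup_pair, sup_eq_right.2 h] at h1
  rw [h1]
  exact le_iSup₂_of_le (f := fun k (_ : k ∈ ({f, g} : Set (X ⟶ Y))) => F.act k y) f (by simp) le_rfl

theorem act_mono (F : QMod Q) {X Y : Q} (f : X ⟶ Y) {y y' : F.obj Y} (h : y ≤ y') :
    F.act f y ≤ F.act f y' :=
  OrderHomClass.mono (F.act f) h

theorem le_sSup_act_iff (F : QMod Q) {X Y : Q} (f : X ⟶ Y) (y : F.obj Y) (x : F.obj X) :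
    f ≤ sSup {g : X ⟶ Y | F.act g y ≤ x} ↔ F.act f y ≤ x := by
  refine ⟨fun h => (F.act_mono_left h y).trans ?_, fun h => le_sSup h⟩
  rw [F.act_sSup]
  exact iSup₂_le fun _ h => h

/-- The `Q`-category `𝔸_F` of a module `F`: its objects of type `X` are the elements of `F(X)`,
and `𝔸_F(y, x) = ⋁ {f : tx ⟶ ty | F(f)(y) ≤ x}`. -/
def toQCat (F : QMod Q) : QCategory Q where
  obj := F.obj
  hom {X Y} y x := sSup {f : X ⟶ Y | F.act f y ≤ x}
  comp_le x y z := by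
    rw [F.le_sSup_act_iff, F.act_comp]
    exact (F.act_mono _ ((F.le_sSup_act_iff _ z y).1 le_rfl)).trans
      ((F.le_sSup_act_iff _ y x).1 le_rfl)
  id_le x := by
    rw [F.le_sSup_act_iff, F.act_id]

theorem le_hom_iff (F : QMod Q) {X Y : Q} (f : X ⟶ Y) (y : F.obj Y) (x : F.obj X) :
    f ≤ F.toQCat.hom y x ↔ F.act f y ≤ x :=
  F.le_sSup_act_iff f y x

theorem act_act_le_iff (F : QMod Q) {X Y Z : Q} (f : X ⟶ Y) (g : Y ⟶ Z) (z : F.obj Z)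
    (x : F.obj X) : F.act f (F.act g z) ≤ x ↔ f ≫ g ≤ F.toQCat.hom z x := by
  rw [← F.act_comp, F.le_hom_iff]

/-- `𝔸_F` is cocomplete: the `Φ`-weighted colimit of `G` is `a ↦ ⋁_b F(Φ(b, a))(G b)`. -/
theorem toQCat_cocomplete (F : QMod Q) : F.toQCat.IsCocomplete := by
  intro A B Φ G
  have key : ∀ {X Y : Q} (a : A.obj Y) (x : F.obj X) (f : X ⟶ Y),
      f ≤ F.toQCat.hom (⨆ (Z : Q) (b : B.obj Z),
        F.act (Distributor.el Φ b a) (QFunctor.obj G b) : F.obj Y) x ↔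
      ∀ (Z : Q) (b : B.obj Z),
        f ≫ Distributor.el Φ b a ≤ F.toQCat.hom (QFunctor.obj G b) x := by
    intro X Y a x f
    rw [F.le_hom_iff]
    simp only [map_iSup, iSup_le_iff]
    refine forall_congr' fun Z => forall_congr' fun b => ?_
    exact (act_act_le_iff F f (Distributor.el Φ b a) (QFunctor.obj G b) x)
  refine ⟨QFunctor.mk (B := F.toQCat) (fun {X} a => (⨆ (Z : Q) (b : B.obj Z),
    F.act (Distributor.el Φ b a) (QFunctor.obj G b) : F.obj X)) (fun a' a => ?_), ?_⟩
  · refine (key _ _ _).2 fun Z b => (Distributor.comp_hom_le Φ b a' a).trans ?_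
    have h := (key a _ (𝟙 _)).1 (F.toQCat.id_le _) Z b
    rwa [Category.id_comp] at h
  · rw [isColim_iff]
    exact fun a c f => key a c f

theorem act_app_le {F G : QMod Q} (α : F ⟶ G) {X Y : Q} (f : X ⟶ Y) (y : F.obj Y)
    (x : F.obj X) (h : F.act f y ≤ x) : G.act f (Hom.app α Y y) ≤ Hom.app α X x := by
  rw [← Hom.naturality α]
  exact OrderHomClass.mono (Hom.app α X) h

/-- The functor `F_α : 𝔸_F ⟶ 𝔸_G`, `x ↦ α(x)`, of a module morphism `α : F ⟶ G`. -/
def mapQCat {F G : QMod Q} (α : F ⟶ G) : F.toQCat ⟶ G.toQCat :=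
  QFunctor.mk (A := F.toQCat) (B := G.toQCat) (fun {X} x => Hom.app α X x) (fun y x =>
    (G.le_hom_iff _ _ _).2 (act_app_le α _ y x ((F.le_hom_iff _ y x).1 le_rfl)))

theorem le_hom_app_iff {F G : QMod Q} (α : F ⟶ G) {X Y : Q} (f : X ⟶ Y) (y : F.obj Y)
    (x : G.obj X) : f ≤ G.toQCat.hom (Hom.app α Y y) x ↔
      f ≤ F.toQCat.hom y (sSup {z : F.obj X | Hom.app α X z ≤ x} : F.obj X) := by
  rw [G.le_hom_iff, F.le_hom_iff, ← Hom.naturality α]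
  refine ⟨fun h => le_sSup h, fun h => (OrderHomClass.mono (Hom.app α X) h).trans ?_⟩
  rw [map_sSup]
  exact sSup_le (by rintro _ ⟨z, hz, rfl⟩; exact hz)

theorem mapQCat_cocontinuous {F G : QMod Q} (α : F ⟶ G) : IsCocontinuous (mapQCat α) := by
  intro A B Φ H K hK
  rw [isColim_iff] at hK ⊢
  intro X Y a x f
  refine (le_hom_app_iff α f (QFunctor.obj K a) x).trans ((hK a _ f).trans ?_)
  exact forall_congr' fun Z => forall_congr' fun b => (le_hom_app_iff α _ _ x).symm

/-- The cocomplete `Q`-category `𝔸_F`. -/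
def toCocont (F : QMod Q) : Cocont Q := ⟨F.toQCat, F.toQCat_cocomplete⟩

end QMod

/-- The 2-functor `Mod(Q) ⟶ Cocont(Q)` sending `F` to `𝔸_F` and `α` to `F_α`. -/
def modToCocont (Q : Type u) [Quantaloid.{u} Q] : TwoFunctor (QMod Q) (Cocont Q) where
  obj F := F.toCocont
  map α := Cocont.Hom.mk (QMod.mapQCat α) (QMod.mapQCat_cocontinuous α)
  map_id _ := rfl
  map_comp _ _ := rfl
  map_mono {F G} α β h := fun X x => by
    exact (G.le_hom_iff (𝟙 X) (QMod.Hom.app α X x) (QMod.Hom.app β X x)).2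
      ((G.act_id X _).trans_le (h X x))

/-! Everything is expressed through suprema of tensors `⋁ i, g i ⊗ y i` in a `Q`-category. These are
particular weighted colimits, so they exist in a cocomplete `Q`-category and are preserved by
cocontinuous functors. In `𝔸_F` such a supremum is exactly `⋁ i, F(g i)(y i)`
(`QMod.isTensorSup_iff`). With all weights identities it is a supremum in a fibre; with a single
term it is the action of an arrow. A cocontinuous functor `𝔸_F ⟶ 𝔸_G` is therefore the same thing as
a module morphism, and the order on functors is the pointwise one.

For essential surjectivity, the isomorphism classes of objects of a cocomplete `𝔸` form a module
under suprema and tensors (`Cocont.toMod`). The functor from `𝔸` to the category of this module is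
fully faithful and surjective on objects, and a choice of representatives inverts it up to
isomorphism.

Both compactness notions say that `𝔸_F(a, -)` preserves suprema of tensors. For `Θ(a, a)` this
follows from the elementwise formula for extensions and the Yoneda lemma
(`Cocont.isTotallyCompact_iff`). For principal elements, a right adjoint of `τ_a` can only be `x ↦
𝔸_F(a, x)`, so the question is whether this map is a module morphism (`QMod.isAdj_tau_iff`).
Likewise, total algebraicity and principal generation both say that the elements in question detect
the order: if `𝔸_F(a, x) ≤ 𝔸_F(a, y)` for all such `a`, then `x ≤ y`. -/

namespace LocOrd

variable {C : Type u} [LocOrd.{v} C]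

/-- Isomorphic parallel morphisms are isomorphic in the hom-category. -/
def Iso₂.toIso {X Y : C} {f g : X ⟶ Y} (h : Iso₂ f g) : f ≅ g where
  hom := homOfLE h.1
  inv := homOfLE h.2
  hom_inv_id := Subsingleton.elim _ _
  inv_hom_id := Subsingleton.elim _ _

/-- Mutually inverse morphisms, up to isomorphism, form an equivalence. -/
def equivalenceOfIso₂ {X Y : C} (f : X ⟶ Y) (g : Y ⟶ X) (h : Iso₂ (𝟙 X) (f ≫ g))
    (h' : Iso₂ (g ≫ f) (𝟙 Y)) : Bicategory.Equivalence X Y where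
  hom := f
  inv := g
  unit := h.toIso
  counit := h'.toIso
  left_triangle := Iso.ext (Subsingleton.elim _ _)

end LocOrd

namespace TwoFunctor

variable {C : Type*} [LocOrd C] {D : Type*} [LocOrd D]

/-- A 2-functor is a biequivalence as soon as it reflects the order, is full up to isomorphism
on morphisms and surjective on objects up to equivalence. -/
theorem isBiequivalence (T : TwoFunctor C D)
    (hle : ∀ {X Y : C} (f g : X ⟶ Y), T.map f ≤ T.map g → f ≤ g)
    (hmap : ∀ {X Y : C} (k : T.obj X ⟶ T.obj Y), ∃ f : X ⟶ Y, LocOrd.Iso₂ (T.map f) k)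
    (hobj : ∀ Z : D, ∃ X : C, Nonempty (Bicategory.Equivalence (T.obj X) Z)) :
    IsBiequivalence T.toPseudofunctor := by
  refine ⟨fun X Y => ?_, hobj⟩
  refine { faithful := ⟨fun _ => Subsingleton.elim _ _⟩, full := ⟨fun {f g} η => ?_⟩,
           essSurj := ⟨fun k => ?_⟩ }
  · exact ⟨homOfLE (hle f g (leOfHom η)), Subsingleton.elim _ _⟩
  · obtain ⟨f, hf⟩ := hmap k
    exact ⟨f, ⟨hf.toIso⟩⟩

end TwoFunctor

/-! ### Extensions of distributors -/

namespace DistCat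

open QCategory

variable {Q : Type u} [Quantaloid.{u} Q]

/-- Extensions of distributors, elementwise. -/
theorem le_ext_el {A B C : DistCat Q} (Φ : A ⟶ B) (Ψ : A ⟶ C) {X Y : Q} (c : C.cat.obj Y)
    (b : B.cat.obj X) (f : X ⟶ Y) :
    f ≤ Distributor.el (Quantaloid.ext Φ Ψ) c b ↔
      ∀ (Z : Q) (a : A.cat.obj Z), Distributor.el Φ b a ≫ f ≤ Distributor.el Ψ c a := by
  constructor
  · intro h Z a
    refine (Quantaloid.comp_mono_right _ h).trans ?_
    have hext : Φ ≫ Quantaloid.ext Φ Ψ ≤ Ψ := by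
      rw [Quantaloid.ext, Quantaloid.comp_sSup]
      exact iSup₂_le fun _ h => h
    refine le_trans ?_ (hext Z Y c a)
    exact le_iSup₂_of_le
      (f := fun W b' => Distributor.el Φ b' a ≫ Distributor.el (Quantaloid.ext Φ Ψ) c b')
      X b le_rfl
  · intro h
    let Θ : B ⟶ C := Distributor.mk
      (fun {X Y} c b => sSup {f : X ⟶ Y | ∀ (Z : Q) (a : A.cat.obj Z),
        Distributor.el Φ b a ≫ f ≤ Distributor.el Ψ c a})
      (fun c c' b => by
        rw [Quantaloid.sSup_comp]
        refine iSup₂_le fun g hg => le_sSup fun Z a => ?_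
        rw [← Category.assoc]
        exact (Quantaloid.comp_mono_left (hg Z a) _).trans (Distributor.hom_comp_le Ψ c c' a))
      (fun c b' b => by
        rw [Quantaloid.comp_sSup]
        refine iSup₂_le fun g hg => le_sSup fun Z a => ?_
        rw [← Category.assoc]
        exact (Quantaloid.comp_mono_left (Distributor.hom_comp_le Φ b' b a) g).trans (hg Z a))
    have hΘ : Θ ≤ Quantaloid.ext Φ Ψ := by
      refine le_sSup ?_
      change Φ ≫ Θ ≤ Ψ
      intro X Z c a
      refine iSup₂_le fun Y b => ?_
      change _ ≫ sSup _ ≤ _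
      rw [Quantaloid.comp_sSup]
      exact iSup₂_le fun g hg => hg X a
    have hf : f ≤ Distributor.el Θ c b :=
      le_sSup (show f ∈ {f : X ⟶ Y | ∀ (Z : Q) (a : A.cat.obj Z),
        Distributor.el Φ b a ≫ f ≤ Distributor.el Ψ c a} from h)
    exact hf.trans (hΘ X Y c b)

end DistCat

/-! ### Suprema of tensors, and fully faithful functors surjective on objects -/

namespace QCategory

variable {Q : Type u} [Quantaloid.{u} Q]

theorem comp_le_hom (A : QCategory Q) {X Y Z : Q} {a : A.obj X} {a' : A.obj Y} {a'' : A.obj Z}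
    {f : X ⟶ Y} {g : Y ⟶ Z} (hf : f ≤ A.hom a' a) (hg : g ≤ A.hom a'' a') :
    f ≫ g ≤ A.hom a'' a :=
  (LocOrd.comp_mono hf hg).trans (A.comp_le a a' a'')

/-- If `a' ≤ a` in the underlying order, then `𝔸(b, a') ≤ 𝔸(b, a)`. -/
theorem hom_mono_right (A : QCategory Q) {X Y : Q} (b : A.obj Y) {a a' : A.obj X}
    (h : 𝟙 X ≤ A.hom a' a) : A.hom b a' ≤ A.hom b a := by
  simpa using A.comp_le_hom h (le_refl (A.hom b a'))

/-- If `b ≤ b'` in the underlying order, then `𝔸(b', a) ≤ 𝔸(b, a)`. -/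
theorem hom_mono_left (A : QCategory Q) {X Y : Q} {b b' : A.obj Y} (a : A.obj X)
    (h : 𝟙 Y ≤ A.hom b b') : A.hom b' a ≤ A.hom b a := by
  simpa using A.comp_le_hom (le_refl (A.hom b' a)) h

/-- `c` is the supremum of the tensors `g i ⊗ y i`. -/
def IsTensorSup (A : QCategory Q) {ι : Type u} {X : Q} {Y : ι → Q} (g : ∀ i, X ⟶ Y i)
    (y : ∀ i, A.obj (Y i)) (c : A.obj X) : Prop :=
  ∀ {W : Q} (x : A.obj W) (f : W ⟶ X), f ≤ A.hom c x ↔ ∀ i, f ≫ g i ≤ A.hom (y i) x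

theorem IsTensorSup.id_le_hom {A : QCategory Q} {ι : Type u} {X : Q} {Y : ι → Q}
    {g : ∀ i, X ⟶ Y i} {y : ∀ i, A.obj (Y i)} {c c' : A.obj X} (h : A.IsTensorSup g y c)
    (h' : A.IsTensorSup g y c') : 𝟙 X ≤ A.hom c c' :=
  (h _ _).2 ((h' _ _).1 (A.id_le c'))

/-- The presheaf `⋁ i, 𝔸(-, y i) ∘ g i`. -/
def tensorPresheaf (A : QCategory Q) {ι : Type u} {X : Q} {Y : ι → Q} (g : ∀ i, X ⟶ Y i)
    (y : ∀ i, A.obj (Y i)) : A.presheaf.obj X :=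
  Distributor.mk (A := star X) (B := A)
    (fun {W Z} (b : A.obj Z) (s : Star X W) =>
      match W, s with
      | _, Star.pt => ⨆ i, g i ≫ A.hom b (y i))
    (fun b b' s => by
      cases s
      simp only [Quantaloid.iSup_comp, Category.assoc]
      exact iSup_mono fun i => Quantaloid.comp_mono_right (g i) (A.comp_le (y i) b' b))
    (fun b s' s => by
      cases s
      cases s'
      exact (Category.id_comp _).le)

theorem tensorPresheaf_el (A : QCategory Q) {ι : Type u} {X : Q} {Y : ι → Q} (g : ∀ i, X ⟶ Y i)
    (y : ∀ i, A.obj (Y i)) {Z : Q} (b : A.obj Z) :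
    Distributor.el (A.tensorPresheaf g y) b (pt X) = ⨆ i, g i ≫ A.hom b (y i) :=
  rfl

/-- A Yoneda reduction: the weight is built from representables, so the condition at all objects `b`
follows from the conditions at `b = y i`, where `1 ≤ 𝔸(y i, y i)`. -/
theorem isColim_tensorPresheaf_iff {A B : QCategory Q} {ι : Type u} {X : Q} {Y : ι → Q}
    (g : ∀ i, X ⟶ Y i) (y : ∀ i, A.obj (Y i)) (H : A ⟶ B) (K : star X ⟶ B) :
    IsColim (A.tensorPresheaf g y) H K ↔
      B.IsTensorSup g (fun i => QFunctor.obj H (y i)) (QFunctor.obj K (pt X)) := by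
  have key : ∀ {W : Q} (x : B.obj W) (f : W ⟶ X),
      (∀ (Z : Q) (b : A.obj Z), f ≫ Distributor.el (A.tensorPresheaf g y) b (pt X) ≤
        B.hom (QFunctor.obj H b) x) ↔ ∀ i, f ≫ g i ≤ B.hom (QFunctor.obj H (y i)) x := by
    intro W x f
    simp only [tensorPresheaf_el, Quantaloid.comp_iSup, iSup_le_iff]
    refine ⟨fun h i => ?_, fun h Z b i => ?_⟩
    · refine le_trans ?_ (h _ (y i) i)
      rw [← Category.assoc]
      simpa using Quantaloid.comp_mono_right (f ≫ g i) (A.id_le (y i))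
    · rw [← Category.assoc]
      exact B.comp_le_hom (h i) (QFunctor.map_le H b (y i))
  refine (isColim_iff (A := star X) (A.tensorPresheaf g y) H K).trans ?_
  constructor
  · intro h W x f
    exact (h (pt X) x f).trans (key x f)
  · intro h W V s x f
    cases s
    exact (h x f).trans (key x f).symm

/-- A cocontinuous functor preserves suprema of tensors. -/
theorem IsCocontinuous.map_isTensorSup {A B : QCategory Q} {H : A ⟶ B} (hH : IsCocontinuous H)
    {ι : Type u} {X : Q} {Y : ι → Q} {g : ∀ i, X ⟶ Y i} {y : ∀ i, A.obj (Y i)} {c : A.obj X}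
    (hc : A.IsTensorSup g y c) :
    B.IsTensorSup g (fun i => QFunctor.obj H (y i)) (QFunctor.obj H c) :=
  (isColim_tensorPresheaf_iff g y (𝟙 A ≫ H) (A.delta c ≫ H)).1
    (hH _ _ _ _ _ ((isColim_tensorPresheaf_iff g y (𝟙 A) (A.delta c)).2 hc))

theorem IsCocomplete.exists_isTensorSup {A : QCategory Q} (hA : A.IsCocomplete)
    {ι : Type u} {X : Q} {Y : ι → Q} (g : ∀ i, X ⟶ Y i) (y : ∀ i, A.obj (Y i)) :
    ∃ c : A.obj X, A.IsTensorSup g y c := by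
  obtain ⟨K, hK⟩ := hA (star X) A (A.tensorPresheaf g y) (𝟙 A)
  exact ⟨_, (isColim_tensorPresheaf_iff g y (𝟙 A) K).1 hK⟩

/-- The Yoneda lemma. -/
theorem presheaf_hom_yoneda (A : QCategory Q) {X Y : Q} (b : A.obj Y) (φ : A.presheaf.obj X) :
    A.presheaf.hom (QFunctor.obj A.yoneda b) φ = Distributor.el φ b (pt X) := by
  refine eq_of_forall_le_iff fun f => (A.le_presheaf_hom _ _ _).trans ⟨fun h => ?_, fun h Z a => ?_⟩
  · have h1 := (Quantaloid.comp_mono_right f (A.id_le b)).trans (h Y b)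
    rwa [Category.comp_id] at h1
  · exact (Quantaloid.comp_mono_left h _).trans (Distributor.hom_comp_le φ a b (pt X))

/-- Fully faithful functors. -/
def IsFullyFaithful {A B : QCategory Q} (H : A ⟶ B) : Prop :=
  ∀ {X Y : Q} (y : A.obj Y) (x : A.obj X),
    B.hom (QFunctor.obj H y) (QFunctor.obj H x) = A.hom y x

/-- Functors that are surjective on objects. -/
def IsSurjective {A B : QCategory Q} (H : A ⟶ B) : Prop :=
  ∀ (X : Q) (b : B.obj X), ∃ a : A.obj X, QFunctor.obj H a = b

/-- The universal property of a colimit is tested against objects of `B`; all of them lie in the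
image of `H`, where the hom-arrows are those of `A`. -/
theorem IsFullyFaithful.cocontinuous {A B : QCategory Q} {H : A ⟶ B} (hH : IsFullyFaithful H)
    (hs : IsSurjective H) : IsCocontinuous H := by
  intro C D Φ F K hK
  rw [isColim_iff] at hK ⊢
  intro X Y a b f
  obtain ⟨b, rfl⟩ := hs X b
  change f ≤ B.hom (QFunctor.obj H _) _ ↔ ∀ Z d, _ ≤ B.hom (QFunctor.obj H _) _
  simp only [hH _ b]
  exact hK a b f

/-- Such a `G` is left adjoint to `H`, because `A(Gb, a) = B(HGb, Ha) = B(b, Ha)`, and left adjoints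
preserve colimits. -/
theorem IsFullyFaithful.cocontinuous_of_comp_eq {A B : QCategory Q} {H : A ⟶ B}
    (hH : IsFullyFaithful H) {G : B ⟶ A} (hG : G ≫ H = 𝟙 B) : IsCocontinuous G := by
  have key : ∀ {X Y : Q} (b : B.obj Y) (a : A.obj X),
      A.hom (QFunctor.obj G b) a = B.hom b (QFunctor.obj H a) := by
    intro X Y b a
    rw [← hH]
    exact congrArg (fun K : B ⟶ B => B.hom (QFunctor.obj K b) (QFunctor.obj H a)) hG
  intro C D Φ F K hK
  rw [isColim_iff] at hK ⊢
  intro X Y c a f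
  change f ≤ A.hom (QFunctor.obj G _) _ ↔ ∀ Z d, _ ≤ A.hom (QFunctor.obj G _) _
  simp only [key]
  exact hK c _ f

theorem IsFullyFaithful.isTensorSup_iff {A B : QCategory Q} {H : A ⟶ B} (hH : IsFullyFaithful H)
    (hs : IsSurjective H) {ι : Type u} {X : Q} {Y : ι → Q} (g : ∀ i, X ⟶ Y i)
    (y : ∀ i, A.obj (Y i)) (c : A.obj X) :
    B.IsTensorSup g (fun i => QFunctor.obj H (y i)) (QFunctor.obj H c) ↔ A.IsTensorSup g y c := by
  constructor
  · intro h W x f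
    simpa only [hH _ x] using h (QFunctor.obj H x) f
  · exact (hH.cocontinuous hs).map_isTensorSup

end QCategory

/-! ### Totally compact objects and total algebraicity -/

namespace Cocont

open QCategory

variable {Q : Type u} [Quantaloid.{u} Q]

/-- The adjunction `sup ⊣ Y` in hom form, `𝔸(sup φ, x) = 𝒫𝔸(φ, Yx)`, obtained from its unit and
counit. -/
theorem le_hom_sup_iff (A : Cocont Q) {X Y : Q} (φ : A.cat.presheaf.obj Y) (x : A.cat.obj X)
    (f : X ⟶ Y) : f ≤ A.cat.hom (QFunctor.obj A.sup φ) x ↔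
      ∀ (Z : Q) (b : A.cat.obj Z), f ≫ Distributor.el φ b (pt Y) ≤ A.cat.hom b x := by
  have hunit := A.sup_isAdj.1 Y φ
  have hcounit := A.sup_isAdj.2 X x
  refine Iff.trans ⟨fun h => ?_, fun h => ?_⟩
    (A.cat.le_presheaf_hom φ (QFunctor.obj A.cat.yoneda x) f)
  · exact (h.trans (QFunctor.map_le A.cat.yoneda _ _)).trans
      (A.cat.presheaf.hom_mono_left _ hunit)
  · exact (h.trans (QFunctor.map_le A.sup _ _)).trans (A.cat.hom_mono_right _ hcounit)

/-- The elementwise formula for the extension, taken at the arrow `1`, gives `𝔸(a, sup φ) ≤ 𝒫𝔸(Ya,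
φ)`; the Yoneda lemma evaluates the right side. -/
theorem isTotallyCompact_iff_sup (A : Cocont Q) {X : Q} (a : A.cat.obj X) :
    A.IsTotallyCompact a ↔ ∀ (Z : Q) (φ : A.cat.presheaf.obj Z),
      A.cat.hom a (QFunctor.obj A.sup φ) ≤ Distributor.el φ a (pt Z) := by
  refine (DistCat.le_ext_el (lowerStar A.sup) (upperStar A.cat.yoneda) a a (𝟙 X)).trans ?_
  refine forall₂_congr fun Z φ => ?_
  rw [Category.comp_id, ← A.cat.presheaf_hom_yoneda a φ]
  exact Iff.rfl

/-- `a` is totally compact exactly when `𝔸(a, -)` preserves suprema of tensors. -/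
theorem isTotallyCompact_iff (A : Cocont Q) {X : Q} (a : A.cat.obj X) :
    A.IsTotallyCompact a ↔ ∀ (Z : Q) (ι : Type u) (Y : ι → Q) (g : ∀ i, Z ⟶ Y i)
      (y : ∀ i, A.cat.obj (Y i)) (c : A.cat.obj Z), A.cat.IsTensorSup g y c →
        A.cat.hom a c ≤ ⨆ i, g i ≫ A.cat.hom a (y i) := by
  rw [isTotallyCompact_iff_sup]
  constructor
  · intro h Z ι Y g y c hc
    rw [← tensorPresheaf_el]
    -- Here `c ≤ sup` of the presheaf generated by the tensors, since the value of that presheaf at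
    -- `y i` is at least `g i`.
    refine le_trans (A.cat.hom_mono_right a ((hc _ _).2 fun i => ?_))
      (h Z (A.cat.tensorPresheaf g y))
    have h1 := (A.le_hom_sup_iff (A.cat.tensorPresheaf g y) _ (𝟙 Z)).1 (A.cat.id_le _) (Y i) (y i)
    refine le_trans (Quantaloid.comp_mono_right _ ?_) h1
    rw [tensorPresheaf_el]
    refine le_iSup_of_le i ?_
    simpa using Quantaloid.comp_mono_right (g i) (A.cat.id_le (y i))
  · intro h Z φ
    -- Conversely, `sup φ` is the supremum of the tensors `φ(b) ⊗ b` over all objects `b` of `𝔸`.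
    refine (h Z (Σ W, A.cat.obj W) Sigma.fst (fun b => Distributor.el φ b.2 (pt Z)) Sigma.snd
      (QFunctor.obj A.sup φ) fun x f => ?_).trans (iSup_le fun b => Distributor.hom_comp_le φ a b.2 _)
    rw [le_hom_sup_iff]
    exact ⟨fun h b => h b.1 b.2, fun h Z b => h ⟨Z, b⟩⟩

/-- `𝔸` is totally algebraic exactly when the totally compact objects detect the order. -/
theorem isTotallyAlgebraic_iff (A : Cocont Q) :
    A.IsTotallyAlgebraic ↔ ∀ (X : Q) (x y : A.cat.obj X),
      (∀ (Z : Q) (a : A.cat.obj Z), A.IsTotallyCompact a → A.cat.hom a x ≤ A.cat.hom a y) →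
        𝟙 X ≤ A.cat.hom x y := by
  constructor
  · rintro ⟨K, hK, hK'⟩ X x y hxy
    -- The pointwise candidate for the Kan extension: `k x` is the supremum of `𝔸(b, x) ⊗ b` over
    -- totally compact `b`.
    have hsup : ∀ (X : Q) (x : A.cat.obj X), ∃ c : A.cat.obj X, A.cat.IsTensorSup
        (fun b : Σ W, A.compacts.obj W => A.cat.hom b.2.1 x) (fun b => b.2.1) c :=
      fun X x => A.cocomplete.exists_isTensorSup _ _
    choose k hk using hsup
    let K' : A.cat ⟶ A.cat := QFunctor.mk (A := A.cat) (B := A.cat) (fun {X} x => k X x)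
      (fun {X Y} x' x => (hk _ _ _ _).2 fun b =>
        (A.cat.comp_le x x' b.2.1).trans (by
          simpa using (hk _ x _ _).1 (A.cat.id_le _) b))
    -- For totally compact `a`, the term `b = a` of `k a` gives `a ≤ k a`, so the universal property
    -- of `K` applies.
    have h1 : K ≤ K' := (hK K').2 fun Z a => by
      refine (?_ : A.cat.hom _ _ ≤ _).trans' (A.cat.id_le a.1)
      have := (hk _ a.1 _ _).1 (A.cat.id_le _) ⟨Z, a⟩
      rwa [Category.id_comp] at this
    have h2 : 𝟙 X ≤ A.cat.hom x (k X x) := le_trans hK'.2 h1 X x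
    refine h2.trans (A.cat.hom_mono_right x ((hk X x _ _).2 fun b => ?_))
    rw [Category.id_comp]
    exact hxy b.1 b.2.1 b.2.2
  · intro h
    refine ⟨𝟙 A.cat, fun H => ⟨fun hH Z a => hH Z a.1, fun hH X x => h X _ _ fun Z a ha => ?_⟩,
      le_rfl, le_rfl⟩
    -- Since `a ≤ Ha`, one has `𝔸(a, x) ≤ 𝔸(Ha, Hx) ≤ 𝔸(a, Hx)`; detection of the order then yields
    -- `x ≤ Hx`.
    exact (QFunctor.map_le H a x).trans (A.cat.hom_mono_left _ (hH Z ⟨a, ha⟩))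

/-- Total compactness involves only hom-arrows and suprema of tensors, which `H` preserves and
reflects. -/
theorem isTotallyCompact_map_iff {A B : Cocont Q} {H : A.cat ⟶ B.cat} (hH : IsFullyFaithful H)
    (hs : IsSurjective H) {X : Q} (a : A.cat.obj X) :
    B.IsTotallyCompact (QFunctor.obj H a) ↔ A.IsTotallyCompact a := by
  rw [isTotallyCompact_iff, isTotallyCompact_iff]
  constructor
  · intro h Z ι Y g y c hc
    simpa only [hH a] using h Z ι Y g _ _ ((hH.isTensorSup_iff hs g y c).2 hc)
  · intro h Z ι Y g y c hc
    choose y' hy' using fun i => hs _ (y i)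
    obtain rfl : (fun i => QFunctor.obj H (y' i)) = y := funext hy'
    obtain ⟨c, rfl⟩ := hs Z c
    simpa only [hH a] using h Z ι Y g _ _ ((hH.isTensorSup_iff hs g y' c).1 hc)

theorem IsTotallyAlgebraic.map {A B : Cocont Q} (hA : A.IsTotallyAlgebraic) {H : A.cat ⟶ B.cat}
    (hH : IsFullyFaithful H) (hs : IsSurjective H) : B.IsTotallyAlgebraic := by
  rw [isTotallyAlgebraic_iff] at hA ⊢
  intro X x y hxy
  obtain ⟨x, rfl⟩ := hs X x
  obtain ⟨y, rfl⟩ := hs X y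
  rw [hH]
  refine hA X x y fun Z a ha => ?_
  rw [← hH, ← hH]
  exact hxy Z _ ((isTotallyCompact_map_iff hH hs a).2 ha)

end Cocont

/-! ### Principal elements and principal generation of modules -/

namespace QMod

open QCategory

variable {Q : Type u} [Quantaloid.{u} Q]

theorem id_le_hom_iff (F : QMod Q) {X : Q} (x y : F.obj X) :
    𝟙 X ≤ F.toQCat.hom x y ↔ x ≤ y := by
  rw [F.le_hom_iff, F.act_id]

/-- The formula satisfies the universal property because the action preserves suprema; equality, not
just isomorphism, holds because the order on each fibre is antisymmetric. -/
theorem isTensorSup_iff (F : QMod Q) {ι : Type u} {X : Q} {Y : ι → Q} (g : ∀ i, X ⟶ Y i)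
    (y : ∀ i, F.obj (Y i)) (c : F.obj X) :
    F.toQCat.IsTensorSup g y c ↔ c = ⨆ i, F.act (g i) (y i) := by
  have key : F.toQCat.IsTensorSup g y (⨆ i, F.act (g i) (y i) : F.obj X) := by
    intro W (x : F.obj W) f
    refine (F.le_hom_iff f _ x).trans ?_
    rw [map_iSup, iSup_le_iff]
    exact forall_congr' fun i => F.act_act_le_iff f (g i) (y i) x
  refine ⟨fun h => le_antisymm ?_ ?_, fun h => h ▸ key⟩
  · exact (F.id_le_hom_iff _ _).1 (h.id_le_hom key)
  · exact (F.id_le_hom_iff _ _).1 (key.id_le_hom h)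

/-- A cocontinuous functor `𝔸_F ⟶ 𝔸_G` preserves suprema of acted-upon elements. -/
theorem map_iSup_act {F G : QMod Q} {H : F.toQCat ⟶ G.toQCat} (hH : IsCocontinuous H)
    {ι : Type u} {X : Q} {Y : ι → Q} (g : ∀ i, X ⟶ Y i) (y : ∀ i, F.obj (Y i)) :
    QFunctor.obj H (⨆ i, F.act (g i) (y i) : F.obj X) =
      (⨆ i, G.act (g i) (QFunctor.obj H (y i)) : G.obj X) :=
  (G.isTensorSup_iff _ _ _).1 (hH.map_isTensorSup ((F.isTensorSup_iff g y _).2 rfl))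

/-- The module morphism underlying a cocontinuous functor `𝔸_F ⟶ 𝔸_G`. -/
def ofCocontinuous {F G : QMod Q} (H : F.toQCat ⟶ G.toQCat) (hH : IsCocontinuous H) : F ⟶ G :=
  Hom.mk (fun X =>
      { toFun := fun x => QFunctor.obj H x
        map_sSup' := fun S => by
          -- Identity weights give preservation of suprema; a one-element family, below, gives
          -- naturality.
          have h := map_iSup_act hH (fun _ : S => 𝟙 X) (fun i => i.1)
          simp only [act_id] at h
          rw [sSup_eq_iSup', h]
          exact (iSup_congr fun i => G.act_id X _).trans (sSup_image' (α := G.obj X)).symm })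
    (fun {X Y} f y => by
      have h := map_iSup_act hH (fun _ : PUnit.{u + 1} => f) (fun _ => y)
      simp only [iSup_const] at h
      exact h)

/-- The inequality `≥` is automatic, as each `F(g i)(y i)` lies below the supremum; only `≤`
expresses compactness. -/
theorem isTotallyCompact_iff (F : QMod Q) {A : Q} (a : F.obj A) :
    F.toCocont.IsTotallyCompact (X := A) a ↔
      ∀ (Z : Q) (ι : Type u) (Y : ι → Q) (g : ∀ i, Z ⟶ Y i) (y : ∀ i, F.obj (Y i)),
        F.toQCat.hom a (⨆ i, F.act (g i) (y i) : F.obj Z) = ⨆ i, g i ≫ F.toQCat.hom a (y i) := by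
  refine (F.toCocont.isTotallyCompact_iff (X := A) a).trans ?_
  constructor
  · intro h Z ι Y g y
    refine le_antisymm (h Z ι Y g y _ ((F.isTensorSup_iff g y _).2 rfl)) (iSup_le fun i => ?_)
    rw [F.le_hom_iff, F.act_comp]
    exact (F.act_mono (g i) ((F.le_hom_iff _ _ _).1 le_rfl)).trans
      (le_iSup (fun i => F.act (g i) (y i)) i)
  · intro h Z ι Y g y c hc
    obtain rfl := (F.isTensorSup_iff g y c).1 hc
    exact (h Z ι Y g y).le

/-- A right adjoint of `τ_a` is `x ↦ 𝔸_F(a, x)`. -/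
theorem isAdj_tau_iff (F : QMod Q) {A : Q} (a : F.obj A) (ρ : F ⟶ yon A) :
    LocOrd.IsAdj (F.tau a) ρ ↔ ∀ (X : Q) (x : F.obj X), Hom.app ρ X x = F.toQCat.hom a x := by
  constructor
  · rintro ⟨h, h'⟩ X x
    refine eq_of_forall_le_iff fun (f : X ⟶ A) => ?_
    refine Iff.trans ?_ (F.le_hom_iff f a x).symm
    refine ⟨fun hf => (F.act_mono_left hf a).trans (h' X x), fun hf => ?_⟩
    exact (h X f).trans (OrderHomClass.mono (Hom.app ρ X) hf)
  · intro h
    refine ⟨fun X (f : X ⟶ A) => ?_, fun X x => ?_⟩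
    · change f ≤ Hom.app ρ X (F.act f a)
      rw [h, F.le_hom_iff]
    · change F.act (Hom.app ρ X x) a ≤ x
      rw [h]
      exact (F.le_hom_iff _ _ _).1 le_rfl

/-- Preserving suprema of tensors amounts to preserving fibrewise suprema and the action, that is,
to `𝔸_F(a, -)` being a module morphism. -/
theorem isTotallyCompact_iff_isPrincipal (F : QMod Q) {A : Q} (a : F.obj A) :
    F.toCocont.IsTotallyCompact (X := A) a ↔ F.IsPrincipal a := by
  rw [isTotallyCompact_iff]
  constructor
  · intro h
    refine ⟨Hom.mk (fun X =>
      { toFun := fun x => F.toQCat.hom a x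
        map_sSup' := fun S => ?_ }) (fun {X Y} f y => ?_), (F.isAdj_tau_iff a _).2 fun _ _ => rfl⟩
    · have h1 := h X S (fun _ => X) (fun _ => 𝟙 X) (fun i => i.1)
      simp only [act_id, Category.id_comp] at h1
      rw [sSup_eq_iSup', h1]
      exact sSup_image'.symm
    · have h1 := h X PUnit (fun _ => Y) (fun _ => f) (fun _ => y)
      simp only [iSup_const] at h1
      exact h1
  · rintro ⟨ρ, hρ⟩ Z ι Y g y
    rw [isAdj_tau_iff] at hρ
    simp only [← hρ, map_iSup, Hom.naturality]
    rfl

theorem yon_hom_app {X A : Q} (η : yon X ⟶ yon A) {Y : Q} (f : Y ⟶ X) :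
    Hom.app η Y f = f ≫ Hom.app η X (𝟙 X) := by
  have h := Hom.naturality η f (𝟙 X)
  rwa [show (yon X).act f (𝟙 X) = f from Category.comp_id f] at h

/-- By Yoneda, a morphism `Q(-, X) ⟶ Q(-, A)` is an arrow `h : X ⟶ A`, and `τ_a ∘ h ≤ τ_x` means
`F(h)(a) ≤ x`. -/
theorem lift_tau_app (F : QMod Q) {X A : Q} (a : F.obj A) (x : F.obj X) :
    Hom.app (Quantaloid.lift (F.tau a) (F.tau x)) X (𝟙 X) = F.toQCat.hom a x := by
  refine le_antisymm ?_ ?_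
  · refine (F.le_hom_iff _ a x).2 ?_
    exact (Quantaloid.lift_comp_le (F.tau a) (F.tau x) X (𝟙 X)).trans_eq (F.act_id X x)
  · have h : (yon A).tau (F.toQCat.hom a x) ≤ Quantaloid.lift (F.tau a) (F.tau x) := by
      rw [Quantaloid.le_lift_iff]
      intro Y (f : Y ⟶ X)
      change F.act (f ≫ F.toQCat.hom a x) a ≤ F.act f x
      rw [F.act_comp]
      exact F.act_mono f ((F.le_hom_iff _ _ _).1 le_rfl)
    exact (Category.id_comp (F.toQCat.hom a x)).symm.le.trans (h X (𝟙 X))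

/-- `F` is principally generated exactly when the principal elements detect the order. -/
theorem isPrincipallyGenerated_iff (F : QMod Q) :
    F.IsPrincipallyGenerated ↔ ∀ (X : Q) (x y : F.obj X),
      (∀ (A : Q) (a : F.obj A), F.IsPrincipal a → F.toQCat.hom a x ≤ F.toQCat.hom a y) →
        x ≤ y := by
  have happ : ∀ {X A Y : Q} (a : F.obj A) (x : F.obj X) (f : Y ⟶ X),
      Hom.app (Quantaloid.lift (F.tau a) (F.tau x) ≫ F.tau a) Y f =
        F.act f (F.act (F.toQCat.hom a x) a) := by
    intro X A Y a x f
    refine Eq.trans (congrArg (fun k : Y ⟶ A => F.act k a) ?_) (F.act_comp f (F.toQCat.hom a x) a)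
    exact (yon_hom_app _ f).trans (congrArg (f ≫ ·) (F.lift_tau_app a x))
  -- Both sides are morphisms out of `Q(-, X)`, hence determined by their values at `1_X`.
  have key : ∀ {X : Q} (x : F.obj X),
      (F.tau x = ⨆ (A : Q) (a : F.obj A) (_ : F.IsPrincipal a),
        Quantaloid.lift (F.tau a) (F.tau x) ≫ F.tau a) ↔
      x = ⨆ (A : Q) (a : F.obj A) (_ : F.IsPrincipal a), F.act (F.toQCat.hom a x) a := by
    intro X x
    have happ' : ∀ {Y : Q} (f : Y ⟶ X), Hom.app (⨆ (A : Q) (a : F.obj A) (_ : F.IsPrincipal a),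
        Quantaloid.lift (F.tau a) (F.tau x) ≫ F.tau a : yon X ⟶ F) Y f =
          F.act f (⨆ (A : Q) (a : F.obj A) (_ : F.IsPrincipal a),
            F.act (F.toQCat.hom a x) a) := by
      intro Y f
      simp only [map_iSup]
      refine (iSup_app (F := yon X) _ Y f).trans (iSup_congr fun A => ?_)
      refine (iSup_app (F := yon X) _ Y f).trans (iSup_congr fun a => ?_)
      exact (iSup_app (F := yon X) _ Y f).trans (iSup_congr fun _ => happ a x f)
    constructor
    · intro h
      have h1 := congrArg (fun α => Hom.app α X (𝟙 X)) h
      exact (F.act_id X x).symm.trans (h1.trans ((happ' (𝟙 X)).trans (F.act_id X _)))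
    · intro h
      exact Hom.ext' fun Y (f : Y ⟶ X) => (congrArg (F.act f) h).trans (happ' f).symm
  refine ⟨fun h X x y hxy => ?_, fun h X x => (key x).2 (le_antisymm ?_ ?_)⟩
  · rw [(key x).1 (h X x)]
    refine iSup_le fun A => iSup₂_le fun a ha => ?_
    exact (F.le_hom_iff _ _ _).1 (hxy A a ha)
  -- Detection is applied to `x` and the supremum, of which `F(𝔸_F(a, x))(a)` is one of the terms.
  · refine h X _ _ fun A a ha => (F.le_hom_iff _ _ _).2 ?_
    exact le_iSup_of_le A (le_iSup₂_of_le
      (f := fun (a : F.obj A) (_ : F.IsPrincipal a) => F.act (F.toQCat.hom a x) a) a ha le_rfl)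
  · exact iSup_le fun A => iSup₂_le fun a _ => (F.le_hom_iff _ _ _).1 le_rfl

theorem isPrincipallyGenerated_iff_isTotallyAlgebraic (F : QMod Q) :
    F.IsPrincipallyGenerated ↔ F.toCocont.IsTotallyAlgebraic := by
  rw [isPrincipallyGenerated_iff, Cocont.isTotallyAlgebraic_iff]
  refine forall_congr' fun X => forall₂_congr fun (x y : F.obj X) => ?_
  refine imp_congr ?_ (F.id_le_hom_iff x y).symm
  exact forall₂_congr fun A (a : F.obj A) =>
    imp_congr_left (F.isTotallyCompact_iff_isPrincipal a).symm

end QMod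

/-! ### The module of isomorphism classes of a cocomplete category -/

namespace Cocont

open QCategory

variable {Q : Type u} [Quantaloid.{u} Q]

/-- Isomorphism of objects of the same type. -/
def isoSetoid (A : QCategory Q) (X : Q) : Setoid (A.obj X) where
  r x y := 𝟙 X ≤ A.hom x y ∧ 𝟙 X ≤ A.hom y x
  iseqv :=
    { refl := fun x => ⟨A.id_le x, A.id_le x⟩
      symm := fun h => ⟨h.2, h.1⟩
      trans := fun h h' =>
        ⟨h.1.trans (A.hom_mono_right _ h'.1), h'.2.trans (A.hom_mono_right _ h.2)⟩ }

/-- Isomorphism classes of objects of type `X`. -/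
def IsoClass (A : QCategory Q) (X : Q) : Type u := Quotient (isoSetoid A X)

namespace IsoClass

variable {A : QCategory Q}

/-- The isomorphism class of an object. -/
def mk {X : Q} (a : A.obj X) : IsoClass A X := Quotient.mk (isoSetoid A X) a

/-- A representative of an isomorphism class. -/
noncomputable def out {X : Q} (x : IsoClass A X) : A.obj X := Quotient.out x

theorem mk_out {X : Q} (x : IsoClass A X) : mk x.out = x := Quotient.out_eq x

theorem out_mk {X : Q} (a : A.obj X) :
    𝟙 X ≤ A.hom (mk a).out a ∧ 𝟙 X ≤ A.hom a (mk a).out :=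
  Quotient.exact (s := isoSetoid A X) (Quotient.out_eq (s := isoSetoid A X) (mk a))

theorem hom_out_mk_left {X Y : Q} (a : A.obj Y) (b : A.obj X) :
    A.hom (mk a).out b = A.hom a b :=
  le_antisymm (A.hom_mono_left _ (out_mk a).2) (A.hom_mono_left _ (out_mk a).1)

theorem hom_out_mk_right {X Y : Q} (a : A.obj Y) (b : A.obj X) :
    A.hom a (mk b).out = A.hom a b :=
  le_antisymm (A.hom_mono_right _ (out_mk b).1) (A.hom_mono_right _ (out_mk b).2)

instance (X : Q) : PartialOrder (IsoClass A X) where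
  le x y := 𝟙 X ≤ A.hom x.out y.out
  le_refl x := A.id_le x.out
  le_trans x y z h h' := h.trans (A.hom_mono_right _ h')
  le_antisymm x y h h' := by
    rw [← mk_out x, ← mk_out y]
    exact Quotient.sound (s := isoSetoid A X) ⟨h, h'⟩

theorem le_iff {X : Q} {x y : IsoClass A X} : x ≤ y ↔ 𝟙 X ≤ A.hom x.out y.out := Iff.rfl

end IsoClass

section Module

variable (A : Cocont Q)

/-- The supremum of the tensors `g i ⊗ y i`. -/
noncomputable def tensorSup {ι : Type u} {X : Q} {Y : ι → Q} (g : ∀ i, X ⟶ Y i)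
    (y : ∀ i, A.cat.obj (Y i)) : A.cat.obj X :=
  (A.cocomplete.exists_isTensorSup g y).choose

theorem isTensorSup_tensorSup {ι : Type u} {X : Q} {Y : ι → Q} (g : ∀ i, X ⟶ Y i)
    (y : ∀ i, A.cat.obj (Y i)) : A.cat.IsTensorSup g y (A.tensorSup g y) :=
  (A.cocomplete.exists_isTensorSup g y).choose_spec

noncomputable instance (X : Q) : SupSet (IsoClass A.cat X) where
  sSup S := IsoClass.mk (A.tensorSup (fun _ : S => 𝟙 X) fun i => i.1.out)

/-- Stronger than the lattice-theoretic property, which is the case `f = 1`: arrows from every type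
are needed for tensors to preserve suprema. -/
theorem le_hom_sSup_iff {X Y : Q} (S : Set (IsoClass A.cat X)) (x : A.cat.obj Y) (f : Y ⟶ X) :
    f ≤ A.cat.hom (sSup S).out x ↔ ∀ y ∈ S, f ≤ A.cat.hom y.out x := by
  refine (IsoClass.hom_out_mk_left _ x).symm ▸ (A.isTensorSup_tensorSup _ _ x f).trans ?_
  simp only [Category.comp_id, Subtype.forall]

noncomputable instance (X : Q) : CompleteLattice (IsoClass A.cat X) :=
  completeLatticeOfSup _ fun S =>
    ⟨fun x hx => (A.le_hom_sSup_iff S (sSup S).out (𝟙 X)).1 (A.cat.id_le _) x hx,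
      fun x hx => (A.le_hom_sSup_iff S x.out (𝟙 X)).2 fun _ hy => hx hy⟩

/-- The tensor of an isomorphism class with an arrow. -/
noncomputable def tensor {X Y : Q} (f : X ⟶ Y) (y : IsoClass A.cat Y) : IsoClass A.cat X :=
  IsoClass.mk (A.tensorSup (fun _ : PUnit.{u + 1} => f) fun _ => y.out)

theorem le_hom_tensor_iff {W X Y : Q} (f : X ⟶ Y) (y : IsoClass A.cat Y) (x : A.cat.obj W)
    (g : W ⟶ X) : g ≤ A.cat.hom (A.tensor f y).out x ↔ g ≫ f ≤ A.cat.hom y.out x := by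
  refine (IsoClass.hom_out_mk_left _ x).symm ▸ (A.isTensorSup_tensorSup _ _ x g).trans ?_
  simp only [forall_const]

/-- This adjointness yields the module axioms: two classes with the same upper bounds are equal. -/
theorem tensor_le_iff {X Y : Q} (f : X ⟶ Y) (y : IsoClass A.cat Y) (x : IsoClass A.cat X) :
    A.tensor f y ≤ x ↔ f ≤ A.cat.hom y.out x.out := by
  rw [IsoClass.le_iff, le_hom_tensor_iff, Category.id_comp]

/-- The module of isomorphism classes of objects of a cocomplete `Q`-category. -/
noncomputable def toMod : QMod Q where
  obj X := IsoClass A.cat X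
  act {X Y} f :=
    { toFun := fun y => A.tensor f y
      map_sSup' := fun S => eq_of_forall_ge_iff fun x => by
        rw [tensor_le_iff, le_hom_sSup_iff, sSup_image, iSup₂_le_iff]
        exact forall₂_congr fun y _ => (A.tensor_le_iff f y x).symm }
  -- At `f = 1` the right side of `tensor_le_iff` is the definition of the order.
  act_id X x := eq_of_forall_ge_iff fun y => A.tensor_le_iff (𝟙 X) x y
  act_comp f g z := eq_of_forall_ge_iff fun x => by
    change A.tensor (f ≫ g) z ≤ x ↔ A.tensor f (A.tensor g z) ≤ x
    rw [tensor_le_iff, tensor_le_iff, le_hom_tensor_iff]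
  act_sSup S y := eq_of_forall_ge_iff fun x => by
    refine (A.tensor_le_iff (sSup S) y x).trans ?_
    rw [sSup_le_iff, iSup₂_le_iff]
    exact forall₂_congr fun f _ => (A.tensor_le_iff f y x).symm

theorem toMod_hom {X Y : Q} (y : IsoClass A.cat Y) (x : IsoClass A.cat X) :
    A.toMod.toQCat.hom y x = A.cat.hom y.out x.out :=
  eq_of_forall_le_iff fun f => (A.toMod.le_hom_iff f y x).trans (A.tensor_le_iff f y x)

/-- The functor sending an object to its isomorphism class. -/
noncomputable def toIsoClass : A.cat ⟶ A.toMod.toQCat :=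
  QFunctor.mk (A := A.cat) (B := A.toMod.toQCat) (fun a => IsoClass.mk a) fun a' a => by
    rw [toMod_hom, IsoClass.hom_out_mk_left, IsoClass.hom_out_mk_right]

theorem toIsoClass_isFullyFaithful : IsFullyFaithful A.toIsoClass := fun y x =>
  (A.toMod_hom (IsoClass.mk y) (IsoClass.mk x)).trans (by
    rw [IsoClass.hom_out_mk_left, IsoClass.hom_out_mk_right])

theorem toIsoClass_isSurjective : IsSurjective A.toIsoClass := fun _ x =>
  ⟨IsoClass.out x, IsoClass.mk_out x⟩

/-- The functor choosing a representative of each isomorphism class. -/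
noncomputable def representative : A.toMod.toQCat ⟶ A.cat :=
  QFunctor.mk (A := A.toMod.toQCat) (B := A.cat) (fun x => IsoClass.out x) fun x' x =>
    (A.toMod_hom x' x).le

theorem representative_comp_toIsoClass : A.representative ≫ A.toIsoClass = 𝟙 A.toMod.toQCat := by
  apply QFunctor.ext
  funext X x
  exact IsoClass.mk_out x

/-- The equivalence of a cocomplete `Q`-category with the one of its isomorphism classes. -/
noncomputable def representativeHom : A.toMod.toCocont ⟶ A :=
  Hom.mk A.representative
    (IsFullyFaithful.cocontinuous_of_comp_eq A.toIsoClass_isFullyFaithful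
      A.representative_comp_toIsoClass)

/-- The pseudo-inverse of `representativeHom`. -/
noncomputable def toIsoClassHom : A ⟶ A.toMod.toCocont :=
  Hom.mk A.toIsoClass (IsFullyFaithful.cocontinuous A.toIsoClass_isFullyFaithful
    A.toIsoClass_isSurjective)

theorem representativeHom_comp : A.representativeHom ≫ A.toIsoClassHom = 𝟙 A.toMod.toCocont :=
  Hom.ext A.representative_comp_toIsoClass

theorem toIsoClassHom_comp : LocOrd.Iso₂ (A.toIsoClassHom ≫ A.representativeHom) (𝟙 A) :=
  ⟨fun _ a => (IsoClass.out_mk a).1, fun _ a => (IsoClass.out_mk a).2⟩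

end Module

end Cocont

/-! ### Comparison of modules with cocomplete categories -/

section Comparison

variable {Q : Type u} [Quantaloid.{u} Q]

theorem modToCocont_map_le_iff {F G : QMod Q} (α β : F ⟶ G) :
    (modToCocont Q).map α ≤ (modToCocont Q).map β ↔ α ≤ β :=
  ⟨fun h X x => (G.id_le_hom_iff _ _).1 (h X x), (modToCocont Q).map_mono⟩

/-- Fullness holds strictly: the module morphism built from `H` has the same underlying map as `H`.
-/
theorem modToCocont_map_surjective {F G : QMod Q}
    (H : (modToCocont Q).obj F ⟶ (modToCocont Q).obj G) :
    ∃ α : F ⟶ G, (modToCocont Q).map α = H :=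
  ⟨QMod.ofCocontinuous (Cocont.Hom.functor H) (Cocont.Hom.cocontinuous H), rfl⟩

end Comparison

theorem theorem13 (Q : Type u) [Quantaloid.{u, u} Q] :
    IsBiequivalence (modToCocont Q).toPseudofunctor ∧
    (∀ (F : QMod Q) (A : Q) (a : F.obj A),
      F.toCocont.IsTotallyCompact (X := A) a ↔ F.IsPrincipal a) ∧
    ∃ h : ∀ F : QMod Q, F.IsPrincipallyGenerated ↔ F.toCocont.IsTotallyAlgebraic,
      IsBiequivalence
        ((modToCocont Q).restrict QMod.IsPrincipallyGenerated Cocont.IsTotallyAlgebraic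
          (fun F hF => (h F).1 hF)).toPseudofunctor := by
  refine ⟨TwoFunctor.isBiequivalence _ (fun α β => (modToCocont_map_le_iff α β).1)
      (fun H => ?_) (fun A => ?_), fun F A a => F.isTotallyCompact_iff_isPrincipal a,
    QMod.isPrincipallyGenerated_iff_isTotallyAlgebraic,
    TwoFunctor.isBiequivalence _ (fun α β => (modToCocont_map_le_iff _ _).1)
      (fun H => ?_) (fun A => ?_)⟩
  · obtain ⟨α, rfl⟩ := modToCocont_map_surjective H
    exact ⟨α, le_rfl, le_rfl⟩
  · exact ⟨A.toMod, ⟨LocOrd.equivalenceOfIso₂ A.representativeHom A.toIsoClassHom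
      ⟨A.representativeHom_comp.ge, A.representativeHom_comp.le⟩ A.toIsoClassHom_comp⟩⟩
  · obtain ⟨α, hα⟩ := modToCocont_map_surjective H
    exact ⟨α, hα.le, hα.ge⟩
  -- Total algebraicity passes to the category of isomorphism classes, so the same equivalence lives
  -- in the full sub-2-category.
  · refine ⟨⟨A.obj.toMod, (QMod.isPrincipallyGenerated_iff_isTotallyAlgebraic _).2
      (A.property.map A.obj.toIsoClass_isFullyFaithful A.obj.toIsoClass_isSurjective)⟩, ⟨?_⟩⟩
    exact LocOrd.equivalenceOfIso₂ (C := LocOrd.FullSub Cocont.IsTotallyAlgebraic)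
      A.obj.representativeHom A.obj.toIsoClassHom
      ⟨A.obj.representativeHom_comp.ge, A.obj.representativeHom_comp.le⟩ A.obj.toIsoClassHom_comp
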